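/- Let $K$ be an algebraically closed field of characteristic $0$. A variety is an integral separated scheme of finite type over $K$, a subvariety is a closed irreducible one, and $X(K)$ denotes the set of $K$-points of $X$. A \emph{distinguished category} is a category $\mathfrak{C}$ together with a covariant functor $\mathcal{F}$ to the category of varieties over $K$ satisfying the following axioms. (A1) Any objects $X,Y$ have a direct product: an object $X\times Y$ with morphisms $\pi_X:X\times Y\to X$ and $\pi_Y:X\times Y\to Y$ such that the induced morphism $\mathcal{F}(X\times Y)\to\mathcal{F}(X)\times_K\mathcal{F}(Y)$ is an isomorphism and such that for all morphisms $\phi:W\to X$, $\psi:W\to Y$ there is a unique $\chi:W\to X\times Y$ with $\pi_X\circ\chi=\phi$ and $\pi_Y\circ\chi=\psi$. (A2) For morphisms $\phi:X\to Z$, $\psi:Y\to Z$ there are finitely many morphisms $\phi_i:X_i\to X\times Y$ ($1\le i\le n$, $n\ge 0$) with $\bigcup_i\mathcal{F}(\phi_i)(\mathcal{F}(X_i))=(\mathcal{F}(X)\times_{\mathcal{F}(Z)}\mathcal{F}(Y))_{\mathrm{red}}\subset\mathcal{F}(X)\times_K\mathcal{F}(Y)$. (A3) There is a final object, and $\mathcal{F}$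 maps it to $\operatorname{Spec}K$. (A4) For every morphism $\phi:X\to Y$ the image $\mathcal{F}(\phi)(\mathcal{F}(X))$ is closed in $\mathcal{F}(Y)$, and there are morphisms $\phi_1:W\to X$, $\phi_2:W\to Z$, $\phi_3:Z\to Y$ with $\phi\circ\phi_1=\phi_3\circ\phi_2$ such that $\mathcal{F}(\phi_1)$ is finite and surjective, $\mathcal{F}(\phi_3)$ has finite fibers, $\mathcal{F}(\phi_2)$ is surjective with irreducible fibers, and $\dim_w\mathcal{F}(\phi_2)^{-1}(\mathcal{F}(\phi_2)(w))$ is constant for $w\in\mathcal{F}(W)$. The objects and morphisms of $\mathfrak{C}$, often identified with their images under $\mathcal{F}$, are called distinguished varieties and distinguished morphisms. A subvariety $W$ of a distinguished variety $X$ is \emph{weakly special} if it is an irreducible component of $\phi(\psi^{-1}(z))$ for some distinguished morphisms $\phi:Y\to X$, $\psi:Y\to Z$ and some $z\in Z(K)$. For a subvariety $V$ of $X$, let $\langle V\rangle_{\mathrm{ws}}$ be the smallest weakly special subvariety of $X$ containing $V$ and set $\delta_{\mathrm{ws}}(V)=\dim\langle V\rangle_{\mathrm{ws}}-\dim V$.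 A subvariety $W\subset V$ is \emph{weakly optimal for $V$ in $X$} if $\delta_{\mathrm{ws}}(U)>\delta_{\mathrm{ws}}(W)$ for every subvariety $U$ with $W\subsetneq U\subset V$. The category \emph{satisfies (A5)} if for every distinguished variety $X$ and every subvariety $V\subset X$ there is a finite set of pairs $(\phi,\psi)$ of distinguished morphisms $\phi:Y_\phi\to X$, $\psi:Y_\phi\to Z_\psi$ such that for every $W$ that is weakly optimal for $V$ in $X$ there are a pair $(\phi,\psi)$ in this set and $z\in Z_\psi(K)$ such that $\phi$ has finite fibers and $\langle W\rangle_{\mathrm{ws}}$ is an irreducible component of $\phi(\psi^{-1}(z))$. Let $X$ be a distinguished variety and let $x\in X(K)$. For a distinguished variety $Z$ let $\Sigma_Z=\Sigma_Z(x)\subset Z(K)$ be the set of all $\phi(y)$, where $\phi:Y\to Z$ is a distinguished morphism and $y\in Y(K)$ is such that $\psi(y)=x$ for some distinguished morphism $\psi:Y\to X$ with finite fibers. The collection $\Sigma=\Sigma(x)$ of all the $\Sigma_Z(x)$ is called the $\Sigma$-orbit of $x$. A weakly special subvariety $W$ of $Z$ is \emph{$\Sigma$-special} if it is an irreducible component of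 $\psi(\phi^{-1}(t))$ for some distinguished morphisms $\psi:Y\to Z$, $\phi:Y\to T$ and some $t\in\Sigma_T$; a point $z\in Z(K)$ is $\Sigma$-special if $\{z\}$ is. For an integer $m\ge 0$, the statement $\mathrm{WML}(Z,\Sigma,m)$ says that every subvariety of $Z$ of dimension at most $m$ that contains a Zariski dense set of $\Sigma$-special points is weakly special. For a subvariety $V\subset Z$, a subvariety $W\subset V$ is \emph{$\Sigma$-optimal (for $V$ in $Z$)} if it is weakly optimal for $V$ in $Z$ and $\langle W\rangle_{\mathrm{ws}}$ is $\Sigma$-special. \textbf{Theorem.} Let $\Sigma$ be the $\Sigma$-orbit of a $K$-point of some distinguished variety in a distinguished category satisfying (A5). Let $Z$ be a distinguished variety and let $\mathcal{S}$ be a class of distinguished varieties such that $Z\in\mathcal{S}$ and such that for every $X'\in\mathcal{S}$ and every subvariety $V'$ of $X'$ the finite set of pairs in (A5) can be chosen with all $Y_\phi,Z_\psi$ belonging to $\mathcal{S}$. Fix an integer $m\ge 0$ and assume that $\mathrm{WML}(X',\Sigma,m)$ holds for every $X'\in\mathcal{S}$. Let $V\subset Z$ be a subvariety of dimension at most $m$.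 Then: (1) there are at most finitely many $\Sigma$-optimal subvarieties for $V$ in $Z$; (2) there is a finite collection $\Delta$ of $\Sigma$-special subvarieties of $Z$, none of which contains $V$, such that every proper $\Sigma$-optimal subvariety of $V$ is contained in a subvariety from $\Delta$. -/

import Mathlib

open CategoryTheory AlgebraicGeometry

universe u v w

namespace DistCat

/-! ### Varieties over a field, points, subvarieties, dimension -/

section Varieties

/-- A variety over `K` is an integral separated scheme of finite type over `K`. -/
def IsVariety (K : Type u) [Field K] : ObjectProperty (Over (Spec (.of K))) := fun X =>
  IsIntegral X.left ∧ IsSeparated X.hom ∧ LocallyOfFiniteType X.hom ∧ QuasiCompact X.hom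

/-- The category of varieties over `K` and morphisms of schemes over `K`. -/
abbrev Variety (K : Type u) [Field K] := (IsVariety K).FullSubcategory

variable {K : Type u} [Field K]

/-- The underlying topological space of (the scheme) `X`. -/
abbrev Variety.Space (X : Variety K) : Type u := (X.obj.left : Scheme.{u})

/-- The map on underlying topological spaces induced by a morphism of varieties. -/
noncomputable def Variety.map {X Y : Variety K} (f : X ⟶ Y) : X.Space → Y.Space := fun p => f.hom.left p

/-- `X(K)`: the set of `K`-morphisms `Spec K ⟶ X`. -/
abbrev Variety.Point (X : Variety K) : Type u := Over.mk (𝟙 (Spec (.of K))) ⟶ X.obj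

/-- The point of the underlying space given by a `K`-point. -/
noncomputable def Variety.Point.pt {X : Variety K} (x : X.Point) : X.Space :=
  (show Spec (.of K) ⟶ X.obj.left from x.left) (IsLocalRing.closedPoint K)

/-- The image of a `K`-point under a morphism of varieties. -/
noncomputable def Variety.mapPoint {X Y : Variety K} (f : X ⟶ Y) (x : X.Point) : Y.Point := x ≫ f.hom

/-- A morphism has finite fibers. -/
def Variety.FiniteFibers {X Y : Variety K} (f : X ⟶ Y) : Prop :=
  ∀ y : Y.Space, (Variety.map f ⁻¹' {y}).Finite

/-- The (closed, irreducible) subvarieties of `X`, given by their underlying sets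
(each is endowed with its reduced scheme structure). -/
def IsSubvariety {T : Type u} [TopologicalSpace T] (W : Set T) : Prop :=
  IsIrreducible W ∧ IsClosed W

/-- `W` is an irreducible component of the set `A`, i.e. a maximal irreducible subset of `A`. -/
def IsComponent {T : Type u} [TopologicalSpace T] (W A : Set T) : Prop :=
  Maximal (fun B => IsIrreducible B ∧ B ⊆ A) W

/-- The (Krull) dimension of a subset as a natural number. It is only applied to subvarieties of
varieties, which are non-empty and finite-dimensional. -/
noncomputable def dim {T : Type u} [TopologicalSpace T] (W : Set T) : ℕ :=
  ((topologicalKrullDim W).unbotD 0).toNat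

/-- The local dimension `dim_p A` of a subset `A` at `p ∈ A`: the infimum of the dimensions of
the open neighborhoods of `p` in `A`. -/
noncomputable def localDim {T : Type u} [TopologicalSpace T] (A : Set T) (p : T) : WithBot ℕ∞ :=
  ⨅ (U : Set T) (_ : IsOpen U ∧ p ∈ U), topologicalKrullDim (A ∩ U : Set T)

end Varieties

/-! ### Distinguished categories -/

section Axioms

variable {K : Type u} [Field K] {C : Type w} [Category.{v} C] (F : C ⥤ Variety K)

/-- The object `P` together with `πX`, `πY` is a direct product of `X` and `Y`: the morphism from
`F(P)` to the fiber product of `F(X)` and `F(Y)` over `K` induced by the projections is an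
isomorphism, and `P` has the universal property of the product in `C`. -/
structure IsDirectProduct {X Y P : C} (πX : P ⟶ X) (πY : P ⟶ Y) : Prop where
  isPullback : IsPullback (F.map πX).hom.left (F.map πY).hom.left
    (F.obj X).obj.hom (F.obj Y).obj.hom
  existsUnique : ∀ {W : C} (φ : W ⟶ X) (ψ : W ⟶ Y), ∃! χ : W ⟶ P, χ ≫ πX = φ ∧ χ ≫ πY = ψ

/-- For a direct product `P` of `X` and `Y` and for morphisms `φ : X ⟶ Z`, `ψ : Y ⟶ Z`, the
canonical morphism from the fiber product of `F(X)` and `F(Y)` over `F(Z)` to `F(P)`. -/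
noncomputable def fiberProductToProduct {X Y Z P : C} {πX : P ⟶ X} {πY : P ⟶ Y}
    (hP : IsDirectProduct F πX πY) (φ : X ⟶ Z) (ψ : Y ⟶ Z) :
    Limits.pullback (F.map φ).hom.left (F.map ψ).hom.left ⟶ (F.obj P).obj.left :=
  hP.isPullback.lift (Limits.pullback.fst _ _) (Limits.pullback.snd _ _) (by
    rw [← Over.w (F.map φ).hom, ← Over.w (F.map ψ).hom, ← Category.assoc, ← Category.assoc,
      Limits.pullback.condition])

/-- A category `C` with a functor `F` to the category of varieties over `K` is a distinguished
category. -/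
structure IsDistinguished : Prop where
  /-- (A1) Direct products. -/
  directProducts : ∀ X Y : C, ∃ (P : C) (πX : P ⟶ X) (πY : P ⟶ Y), IsDirectProduct F πX πY
  /-- (A2) Fibered products. -/
  fiberedProducts : ∀ {X Y Z P : C} (φ : X ⟶ Z) (ψ : Y ⟶ Z) (πX : P ⟶ X) (πY : P ⟶ Y)
    (hP : IsDirectProduct F πX πY),
    ∃ (n : ℕ) (T : Fin n → C) (χ : ∀ i, T i ⟶ P),
      (⋃ i, Set.range (Variety.map (F.map (χ i)))) = Set.range (fiberProductToProduct F hP φ ψ)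
  /-- (A3) Final object. -/
  finalObject : ∃ T : C, Nonempty (Limits.IsTerminal T) ∧ IsIso (F.obj T).obj.hom
  /-- (A4) Fiber dimension. -/
  fiberDimension : ∀ {X Y : C} (φ : X ⟶ Y),
    IsClosed (Set.range (Variety.map (F.map φ))) ∧
    ∃ (W Z : C) (φ₁ : W ⟶ X) (φ₂ : W ⟶ Z) (φ₃ : Z ⟶ Y),
      φ₁ ≫ φ = φ₂ ≫ φ₃ ∧
      IsFinite (F.map φ₁).hom.left ∧
      Function.Surjective (Variety.map (F.map φ₁)) ∧
      Variety.FiniteFibers (F.map φ₃) ∧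
      Function.Surjective (Variety.map (F.map φ₂)) ∧
      (∀ z : (F.obj Z).Space, IsIrreducible (Variety.map (F.map φ₂) ⁻¹' {z})) ∧
      (∃ d : WithBot ℕ∞, ∀ p : (F.obj W).Space,
        localDim (Variety.map (F.map φ₂) ⁻¹' {Variety.map (F.map φ₂) p}) p = d)

end Axioms

/-! ### Weakly special and weakly optimal subvarieties, weak finiteness -/

section WeaklySpecial

variable {K : Type u} [Field K] {C : Type w} [Category.{v} C] (F : C ⥤ Variety K)

/-- For morphisms `φ : Y ⟶ X` and `ψ : Y ⟶ Z` and `z ∈ F(Z)(K)`, the set `φ(ψ⁻¹(z)) ⊆ F(X)`. -/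
def imageOfFiber {X Y Z : C} (φ : Y ⟶ X) (ψ : Y ⟶ Z) (z : (F.obj Z).Point) :
    Set (F.obj X).Space :=
  Variety.map (F.map φ) '' (Variety.map (F.map ψ) ⁻¹' {z.pt})

/-- `W` is a weakly special subvariety of `X`. -/
def IsWeaklySpecial {X : C} (W : Set (F.obj X).Space) : Prop :=
  IsSubvariety W ∧ ∃ (Y Z : C) (φ : Y ⟶ X) (ψ : Y ⟶ Z) (z : (F.obj Z).Point),
    IsComponent W (imageOfFiber F φ ψ z)

/-- The weakly special closure of `V`, i.e. the smallest weakly special subvariety that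
contains `V`. It is defined as the intersection of all weakly special subvarieties that
contain `V`, which is the smallest one as soon as a smallest one exists (as is the case in every
distinguished category), see `wsClosure_eq`. -/
def wsClosure {X : C} (V : Set (F.obj X).Space) : Set (F.obj X).Space :=
  ⋂₀ {W | IsWeaklySpecial F W ∧ V ⊆ W}

theorem wsClosure_eq {X : C} {V W : Set (F.obj X).Space}
    (h : IsLeast {W | IsWeaklySpecial F W ∧ V ⊆ W} W) : wsClosure F V = W :=
  Set.Subset.antisymm (Set.sInter_subset_of_mem h.1) (Set.subset_sInter fun _ h' => h.2 h')

/-- The weak defect of `V`. -/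
noncomputable def weakDefect {X : C} (V : Set (F.obj X).Space) : ℤ :=
  (dim (wsClosure F V) : ℤ) - (dim V : ℤ)

/-- `W` is a subvariety of `V` that is weakly optimal for `V` in `X`. -/
def IsWeaklyOptimal {X : C} (V W : Set (F.obj X).Space) : Prop :=
  IsSubvariety W ∧ W ⊆ V ∧
    ∀ U : Set (F.obj X).Space, IsSubvariety U → W ⊂ U → U ⊆ V → weakDefect F W < weakDefect F U

/-- The set in the axiom of weak finiteness for the subvariety `V` of `X` exists and can be chosen
such that all objects occurring in it belong to the class `S`. -/
def WeakFinitenessWithin (S : Set C) (X : C) (V : Set (F.obj X).Space) : Prop :=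
  ∃ (n : ℕ) (Y Z : Fin n → C) (φ : ∀ i, Y i ⟶ X) (ψ : ∀ i, Y i ⟶ Z i),
    (∀ i, Y i ∈ S ∧ Z i ∈ S) ∧
    ∀ W : Set (F.obj X).Space, IsWeaklyOptimal F V W →
      ∃ (i : Fin n) (z : (F.obj (Z i)).Point), Variety.FiniteFibers (F.map (φ i)) ∧
        IsComponent (wsClosure F W) (imageOfFiber F (φ i) (ψ i) z)

/-- (A5) Weak finiteness. -/
def WeakFiniteness : Prop :=
  ∀ (X : C) (V : Set (F.obj X).Space), IsSubvariety V → WeakFinitenessWithin F Set.univ X V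

end WeaklySpecial

/-! ### Σ-orbits and the weak Mordell-Lang statement -/

section Sigma

variable {K : Type u} [Field K] {C : Type w} [Category.{v} C] (F : C ⥤ Variety K)

/-- The Σ-orbit `Σ_Z(x)` in `Z` of the point `x ∈ X(K)`. -/
def sigmaOrbit {X : C} (x : (F.obj X).Point) (Z : C) : Set (F.obj Z).Point :=
  {z | ∃ (Y : C) (φ : Y ⟶ Z) (ψ : Y ⟶ X) (y : (F.obj Y).Point),
    Variety.FiniteFibers (F.map ψ) ∧ Variety.mapPoint (F.map ψ) y = x ∧
    Variety.mapPoint (F.map φ) y = z}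

/-- `W` is a Σ-special subvariety of `Z`, where `Σ = Σ(x)`. -/
def IsSigmaSpecial {X : C} (x : (F.obj X).Point) {Z : C} (W : Set (F.obj Z).Space) : Prop :=
  IsWeaklySpecial F W ∧ ∃ (Y T : C) (ψ : Y ⟶ Z) (φ : Y ⟶ T), ∃ t ∈ sigmaOrbit F x T,
    IsComponent W (imageOfFiber F ψ φ t)

/-- `z` is a Σ-special point of `Z`. -/
def IsSigmaSpecialPoint {X : C} (x : (F.obj X).Point) {Z : C} (z : (F.obj Z).Point) : Prop :=
  IsSigmaSpecial F x ({z.pt} : Set (F.obj Z).Space)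

/-- The weak Mordell-Lang statement `WML(Z, Σ, m)`, where `Σ = Σ(x)`. -/
def WML {X : C} (x : (F.obj X).Point) (Z : C) (m : ℕ) : Prop :=
  ∀ V : Set (F.obj Z).Space, IsSubvariety V → dim V ≤ m →
    V ⊆ closure {p | p ∈ V ∧ ∃ z : (F.obj Z).Point, IsSigmaSpecialPoint F x z ∧ z.pt = p} →
    IsWeaklySpecial F V

/-- `W` is a Σ-optimal subvariety for `V` in `Z`: it is weakly optimal for `V` in `Z` and its
weakly special closure is Σ-special. -/
def IsSigmaOptimal {X : C} (x : (F.obj X).Point) {Z : C} (V W : Set (F.obj Z).Space) : Prop :=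
  IsWeaklyOptimal F V W ∧ IsSigmaSpecial F x (wsClosure F W)

end Sigma

end DistCat

/-!
Weak finiteness, applied with objects in `S`, gives finitely many pairs `(φ, ψ)` such that the
weakly special closure of each Σ-optimal `W` is a component of some `φ(ψ⁻¹(z))`, where `φ` has
finite fibres. Since `W` is a component of the intersection of `V` with its weakly special closure
(`IsWeaklyOptimal.isComponent`), it suffices to show that for a fixed pair and a fixed dimension of
`W` only finitely many `z` occur (`finite_sigmaOptimalPoints`). The second claim follows by letting
`Δ` consist of the weakly special closures of the proper Σ-optimal subvarieties.

The points `z` that occur are Σ-special (`isSigmaSpecialPoint_of_isSigmaSpecial`). If there are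
infinitely many of them, Noetherianity yields a subvariety `B` of positive dimension in which every
infinite subset of those in `B` is dense. The subvarieties `W` belonging to the points of `B` have
their generic points in the images of the finitely many components `E` of `ψ⁻¹(B) ∩ φ⁻¹(V)`, so one
`E` serves infinitely many of them and hence dominates `B`. Let `U` be the closure of `φ(E)`. As the
dimension of the fibres of `E` over `B` is generically constant,
`dim V ≥ dim U = dim E ≥ dim W + dim B` for one of these `W`; moreover `W ⊊ U`. In particular
`dim B ≤ m`, and `WML` shows that `B` is weakly special. Then the component of `ψ⁻¹(B)` containing
`E` has a weakly special image, which contains `U`, and by the constancy of fibre dimensions in (A4)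
its dimension is at most `dim ⟨W⟩ + dim B`. So the weak defect of `U` is at most that of `W`, which
contradicts the weak optimality of `W`.

Two ingredients carry this argument.

* The formal properties of weakly special and Σ-special subvarieties: they are precisely the
  irreducible sets of the form `φ(ψ⁻¹(z))`, without passing to a component
  (`isWeaklySpecial_iff`, `isSigmaSpecial_iff`), and this class is stable under images and under
  components of preimages (`IsFiberImage.image`, `IsFiberImage.of_isComponent_preimage`).
* Dimension theory, expressed through transcendence degrees of residue fields: these are additive
  under composition (`residueTrdeg_comp`), compute the dimension of the closure of a point
  (`topologicalKrullDim_closure_singleton`), vanish for morphisms with finite fibres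
  (`residueTrdeg_eq_zero_of_locallyQuasiFinite`) and are generically bounded on the base by their
  value at the generic point (`exists_isOpen_forall_residueTrdeg_le`).
-/

/-! ### Dimension and transcendence degree of finitely generated algebras -/

theorem ringKrullDim_eq_of_isIntegral_of_injective {R S : Type*} [CommRing R] [CommRing S]
    [IsDomain S] [Algebra R S] [Algebra.IsIntegral R S] (h : Function.Injective (algebraMap R S)) :
    ringKrullDim S = ringKrullDim R := by
  apply le_antisymm
  · refine Order.krullDim_le_of_strictMono (PrimeSpectrum.comap (algebraMap R S)) ?_
    intro p q hpq
    exact Ideal.IsIntegral.comap_lt_comap (R := R) hpq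
  · refine iSup_le fun l => ?_
    have : FaithfulSMul R S := (faithfulSMul_iff_algebraMap_injective R S).mpr h
    obtain ⟨Q, hQ, hQ'⟩ := Ideal.exists_ideal_over_prime_of_isIntegral_of_isDomain
      (R := R) (S := S) l.head.asIdeal (by simp [(RingHom.injective_iff_ker_eq_bot _).mp h])
    have : Q.LiesOver l.head.asIdeal := ⟨hQ'.symm⟩
    obtain ⟨m, hm, -⟩ := Ideal.exists_ltSeries_of_hasGoingUp l Q
    rw [← hm]
    exact le_iSup (fun l : LTSeries (PrimeSpectrum S) => (l.length : WithBot ℕ∞)) m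

/-- The dimension theorem for affine domains. -/
theorem ringKrullDim_eq_trdeg (k R : Type*) [Field k] [CommRing R] [IsDomain R] [Algebra k R]
    [Algebra.FiniteType k R] :
    ringKrullDim R = (Cardinal.toENat (Algebra.trdeg k R) : WithBot ℕ∞) := by
  obtain ⟨n, g, hg, hint⟩ := exists_integral_inj_algHom_of_fg k R
  algebraize [g.toRingHom]
  have hg' : Function.Injective (algebraMap (MvPolynomial (Fin n) k) R) := hg
  have : FaithfulSMul (MvPolynomial (Fin n) k) R :=
    (faithfulSMul_iff_algebraMap_injective _ R).mpr hg'
  have : IsScalarTower k (MvPolynomial (Fin n) k) R := IsScalarTower.of_algebraMap_eq' (by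
    ext x; exact (g.commutes x).symm)
  rw [ringKrullDim_eq_of_isIntegral_of_injective hg', MvPolynomial.ringKrullDim_of_isNoetherianRing]
  have := lift_trdeg_add_eq k (MvPolynomial (Fin n) k) R
  have h2 : Algebra.trdeg (MvPolynomial (Fin n) k) R = 0 := trdeg_eq_zero
  rw [h2] at this
  have h3 := congrArg Cardinal.toENat this
  simp only [MvPolynomial.trdeg_of_isDomain, Cardinal.lift_zero, add_zero] at h3
  simp at h3
  rw [← h3]
  simp

/-- Relative Noether normalization: a finitely generated domain `R` over a domain `A` is integral,
up to multiplying by nonzero elements of `A`, over a polynomial ring over `A` whose number of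
variables is the relative transcendence degree. -/
theorem exists_aeval_isIntegralElem_smul (A R : Type u) [CommRing A] [CommRing R] [IsDomain A]
    [IsDomain R] [Algebra A R] [FaithfulSMul A R] [Algebra.FiniteType A R] :
    ∃ (n : ℕ) (y : Fin n → R), (n : Cardinal) ≤ Algebra.trdeg A R ∧ ∀ r : R, ∃ a : A, a ≠ 0 ∧
      (MvPolynomial.aeval (R := A) y).toRingHom.IsIntegralElem (algebraMap A R a * r) := by
  let L := FractionRing A
  let F := FractionRing R
  have hinj : Function.Injective (algebraMap R F) := IsFractionRing.injective R F
  have hAF : Function.Injective (algebraMap A F) := by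
    rw [IsScalarTower.algebraMap_eq A R F]
    exact hinj.comp (FaithfulSMul.algebraMap_injective A R)
  have : FaithfulSMul A F := (faithfulSMul_iff_algebraMap_injective A F).mpr hAF
  let : Algebra L F := FractionRing.liftAlgebra A F
  have : IsScalarTower A L F := FractionRing.isScalarTower_liftAlgebra A F
  obtain ⟨s, hs⟩ := ‹Algebra.FiniteType A R›.out
  let T : Subalgebra L F := Algebra.adjoin L (algebraMap R F '' (s : Set R))
  have hRT : ∀ r : R, algebraMap R F r ∈ T := by
    intro r
    have hr : r ∈ Algebra.adjoin A (s : Set R) := by rw [hs]; trivial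
    induction hr using Algebra.adjoin_induction with
    | mem x hx => exact Algebra.subset_adjoin ⟨x, hx, rfl⟩
    | algebraMap a =>
      rw [← IsScalarTower.algebraMap_apply, IsScalarTower.algebraMap_apply A L F]
      exact T.algebraMap_mem _
    | add x y _ _ hx hy => rw [map_add]; exact T.add_mem hx hy
    | mul x y _ _ hx hy => rw [map_mul]; exact T.mul_mem hx hy
  have hTR : ∀ t ∈ T, ∃ a : A, a ≠ 0 ∧ ∃ r : R, algebraMap A F a * t = algebraMap R F r := by
    intro t ht
    induction ht using Algebra.adjoin_induction with
    | mem x hx =>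
      obtain ⟨r, -, rfl⟩ := hx
      exact ⟨1, one_ne_zero, r, by simp⟩
    | algebraMap l =>
      obtain ⟨b, c, hc, rfl⟩ := IsFractionRing.div_surjective (A := A) l
      have hc0 := nonZeroDivisors.ne_zero hc
      refine ⟨c, hc0, algebraMap A R b, ?_⟩
      rw [map_div₀, ← IsScalarTower.algebraMap_apply A L F, ← IsScalarTower.algebraMap_apply A L F,
        ← IsScalarTower.algebraMap_apply A R F]
      have : algebraMap A F c ≠ 0 := (map_ne_zero_iff _ hAF).mpr hc0
      exact mul_div_cancel₀ _ this
    | add x y _ _ hx hy =>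
      obtain ⟨a, ha, r, hr⟩ := hx
      obtain ⟨b, hb, q, hq⟩ := hy
      refine ⟨a * b, mul_ne_zero ha hb, algebraMap A R b * r + algebraMap A R a * q, ?_⟩
      simp only [map_add, map_mul, ← hr, ← hq, ← IsScalarTower.algebraMap_apply A R F]
      ring
    | mul x y _ _ hx hy =>
      obtain ⟨a, ha, r, hr⟩ := hx
      obtain ⟨b, hb, q, hq⟩ := hy
      refine ⟨a * b, mul_ne_zero ha hb, r * q, ?_⟩
      simp only [map_mul, ← hr, ← hq]
      ring
  have : Algebra.FiniteType L T :=
    (Subalgebra.fg_iff_finiteType _).mp (Subalgebra.fg_def.mpr ⟨_, s.finite_toSet.image _, rfl⟩)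
  obtain ⟨n, g, hg, hint⟩ := exists_integral_inj_algHom_of_fg L T
  choose a ha y hy using fun i : Fin n => hTR _ (g (MvPolynomial.X i)).2
  refine ⟨n, y, ?_, ?_⟩
  · have : FaithfulSMul L F := (faithfulSMul_iff_algebraMap_injective L F).mpr
      (algebraMap L F).injective
    have : Algebra.IsAlgebraic R F := IsLocalization.isAlgebraic F (nonZeroDivisors R)
    have : Algebra.IsAlgebraic A L := IsLocalization.isAlgebraic L (nonZeroDivisors A)
    have h1 : Algebra.trdeg A R + Algebra.trdeg R F = Algebra.trdeg A F := trdeg_add_eq A R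
    have h2 : Algebra.trdeg A L + Algebra.trdeg L F = Algebra.trdeg A F := trdeg_add_eq A L
    have h3 : Algebra.trdeg R F = 0 := trdeg_eq_zero
    have h4 : Algebra.trdeg A L = 0 := trdeg_eq_zero
    rw [h3, add_zero] at h1
    rw [h4, zero_add] at h2
    rw [h1, ← h2]
    have h5 := lift_trdeg_le_of_injective (T.val.comp g)
      (Subtype.val_injective.comp hg)
    simpa using h5
  · intro r
    let z : Fin n → F := fun i => algebraMap R F (y i)
    -- the scaled variables generate the same polynomial ring over the fraction field
    let σ : MvPolynomial (Fin n) L →ₐ[L] MvPolynomial (Fin n) L :=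
      MvPolynomial.aeval fun i => MvPolynomial.C (algebraMap A L (a i))⁻¹ * MvPolynomial.X i
    let h : MvPolynomial (Fin n) L →ₐ[L] F := MvPolynomial.aeval z
    have hσ : T.val.comp g = h.comp σ := by
      ext i
      simp only [AlgHom.comp_apply, σ, h, MvPolynomial.aeval_X, map_mul, z, ← hy]
      have : algebraMap A F (a i) ≠ 0 := (map_ne_zero_iff _ hAF).mpr (ha i)
      simp only [MvPolynomial.aeval_C, map_inv₀, ← IsScalarTower.algebraMap_apply A L F]
      rw [inv_mul_cancel_left₀ this]
      rfl
    have h1 : (T.val.comp g).toRingHom.IsIntegralElem (algebraMap R F r) :=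
      (hint ⟨_, hRT r⟩).map T.val.toRingHom
    rw [hσ] at h1
    have h2 : h.toRingHom.IsIntegralElem (algebraMap R F r) := RingHom.IsIntegralElem.of_comp
      (f := σ.toRingHom) (g := h.toRingHom) h1
    let : Algebra (MvPolynomial (Fin n) A) (MvPolynomial (Fin n) L) :=
      MvPolynomial.algebraMvPolynomial
    let : Algebra (MvPolynomial (Fin n) L) F := h.toRingHom.toAlgebra
    let : Algebra (MvPolynomial (Fin n) A) F :=
      (h.toRingHom.comp (algebraMap (MvPolynomial (Fin n) A) (MvPolynomial (Fin n) L))).toAlgebra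
    have : IsScalarTower (MvPolynomial (Fin n) A) (MvPolynomial (Fin n) L) F :=
      IsScalarTower.of_algebraMap_eq' rfl
    have := MvPolynomial.isLocalization (σ := Fin n) (nonZeroDivisors A) L
    obtain ⟨⟨_, m, hm, rfl⟩, hm'⟩ := IsIntegral.exists_multiple_integral_of_isLocalization
      (Submonoid.map (MvPolynomial.C : A →+* MvPolynomial (Fin n) A) (nonZeroDivisors A))
      (Rₘ := MvPolynomial (Fin n) L) (algebraMap R F r) h2
    refine ⟨m, nonZeroDivisors.ne_zero hm, ?_⟩
    have h3 : algebraMap (MvPolynomial (Fin n) A) F =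
        (algebraMap R F).comp (MvPolynomial.aeval (R := A) y).toRingHom := by
      ext b
      · change h (algebraMap (MvPolynomial (Fin n) A) (MvPolynomial (Fin n) L) (MvPolynomial.C b)) =
          _
        simp [h, ← IsScalarTower.algebraMap_apply A L F, ← IsScalarTower.algebraMap_apply A R F]
      · change h (algebraMap (MvPolynomial (Fin n) A) (MvPolynomial (Fin n) L) (MvPolynomial.X b)) =
          _
        simp [h, z]
    refine RingHom.IsIntegralElem.of_map hinj (g := algebraMap R F) ?_
    rw [← h3]
    convert! hm' using 1
    rw [Submonoid.smul_def, Algebra.smul_def, h3]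
    simp

/-- For a finitely generated extension `A ⊆ R` of domains there is a nonzero `s` in `A` such that
the extensions of residue fields at the primes of `R` not containing `s` have at most the
transcendence degree of `R` over `A`. The residue field at a prime is described as a field in
which every element is a quotient of elements of the image of the ring. -/
theorem exists_ne_zero_forall_trdeg_le (A R : Type u) [CommRing A] [CommRing R] [IsDomain A]
    [IsDomain R] [Algebra A R] [FaithfulSMul A R] [Algebra.FiniteType A R] :
    ∃ s : A, s ≠ 0 ∧ ∀ (κ L : Type u) [Field κ] [Field L] [Algebra A κ] [Algebra κ L] [Algebra R L]
      [Algebra A L] [IsScalarTower A κ L] [IsScalarTower A R L], algebraMap A κ s ≠ 0 →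
      (∀ x : L, ∃ a b : R, x = algebraMap R L a / algebraMap R L b) →
      Algebra.trdeg κ L ≤ Algebra.trdeg A R := by
  obtain ⟨n, y, hn, hy⟩ := exists_aeval_isIntegralElem_smul A R
  choose a ha hint using hy
  obtain ⟨t, ht⟩ := ‹Algebra.FiniteType A R›.out
  refine ⟨∏ r ∈ t, a r, Finset.prod_ne_zero_iff.mpr fun r _ => ha r, ?_⟩
  intro κ L _ _ _ _ _ _ _ _ hs hL
  let z : Set L := Set.range fun i => algebraMap R L (y i)
  have hcard : Cardinal.mk z ≤ n := by
    refine (Cardinal.mk_range_le_lift (f := fun i => algebraMap R L (y i))).trans' ?_ |>.trans ?_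
    · exact (Cardinal.lift_uzero _).ge
    · simp
  let D := Algebra.adjoin κ z
  have hgen : ∀ r ∈ t, IsAlgebraic D (algebraMap R L r) := by
    intro r hr
    have h1 := (hint r).map (algebraMap R L)
    let p : MvPolynomial (Fin n) A →+* D :=
      MvPolynomial.eval₂Hom ((algebraMap κ D).comp (algebraMap A κ))
        fun i => ⟨algebraMap R L (y i), Algebra.subset_adjoin ⟨i, rfl⟩⟩
    have h2 : (algebraMap R L).comp (MvPolynomial.aeval (R := A) y).toRingHom =
        (algebraMap D L).comp p := by
      ext b
      · simp [p, ← IsScalarTower.algebraMap_apply A R L, ← IsScalarTower.algebraMap_apply κ D L,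
          ← IsScalarTower.algebraMap_apply A κ L]
      · simp [p]
    rw [h2] at h1
    have h3 : IsIntegral D (algebraMap R L (algebraMap A R (a r) * r)) := h1.of_comp
    have h4 : algebraMap A κ (a r) ≠ 0 := by
      rw [map_prod] at hs
      exact Finset.prod_ne_zero_iff.mp hs r hr
    have h5 : algebraMap R L r = algebraMap D L (algebraMap κ D (algebraMap A κ (a r))⁻¹) *
        algebraMap R L (algebraMap A R (a r) * r) := by
      rw [← IsScalarTower.algebraMap_apply κ D L, map_mul, map_inv₀,
        ← IsScalarTower.algebraMap_apply A κ L, ← IsScalarTower.algebraMap_apply A R L,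
        inv_mul_cancel_left₀]
      rw [IsScalarTower.algebraMap_apply A κ L]
      exact (map_ne_zero_iff _ (algebraMap κ L).injective).mpr h4
    rw [h5]
    exact (isAlgebraic_algebraMap _).mul h3.isAlgebraic
  have hR : ∀ r : R, IsAlgebraic D (algebraMap R L r) := by
    intro r
    have hr : r ∈ Algebra.adjoin A (t : Set R) := by rw [ht]; trivial
    induction hr using Algebra.adjoin_induction with
    | mem x hx => exact hgen x hx
    | algebraMap b =>
      rw [← IsScalarTower.algebraMap_apply, IsScalarTower.algebraMap_apply A κ L,
        IsScalarTower.algebraMap_apply κ D L]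
      exact isAlgebraic_algebraMap _
    | add x y _ _ hx hy => rw [map_add]; exact hx.add hy
    | mul x y _ _ hx hy => rw [map_mul]; exact hx.mul hy
  have : Algebra.IsAlgebraic (Algebra.adjoin κ z) L := ⟨fun x => by
    obtain ⟨b, c, rfl⟩ := hL x
    rw [div_eq_mul_inv]
    exact (hR b).mul (hR c).inv⟩
  exact ((Algebra.IsAlgebraic.trdeg_le_cardinalMk κ z).trans hcard).trans hn

/-! ### Transcendence degrees of residue field extensions -/

/-- The transcendence degree of a ring homomorphism as an extended natural number. -/
noncomputable def RingHom.trdegENat {R S : Type*} [CommRing R] [CommRing S] (f : R →+* S) : ℕ∞ :=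
  let := f.toAlgebra
  Cardinal.toENat (Algebra.trdeg R S)

namespace RingHom

theorem trdegENat_algebraMap (R S : Type*) [CommRing R] [CommRing S] [Algebra R S] :
    (algebraMap R S).trdegENat = Cardinal.toENat (Algebra.trdeg R S) := by
  have : (algebraMap R S).toAlgebra = ‹Algebra R S› := Algebra.algebra_ext _ _ fun _ => rfl
  rw [trdegENat, this]

theorem trdegENat_comp {R S T : Type u} [CommRing R] [CommRing S] [CommRing T] [Nontrivial R]
    [NoZeroDivisors T] (g : S →+* T) (f : R →+* S) (hg : Function.Injective g)
    (hf : Function.Injective f) : (g.comp f).trdegENat = f.trdegENat + g.trdegENat := by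
  algebraize [f, g, g.comp f]
  have : FaithfulSMul R S := (faithfulSMul_iff_algebraMap_injective R S).mpr hf
  have : FaithfulSMul S T := (faithfulSMul_iff_algebraMap_injective S T).mpr hg
  have := congrArg Cardinal.toENat (trdeg_add_eq R S (A := T))
  rw [map_add] at this
  exact this.symm

theorem trdegENat_eq_zero_of_isAlgebraic {R S : Type*} [CommRing R] [CommRing S] (f : R →+* S)
    (h : let := f.toAlgebra; Algebra.IsAlgebraic R S) : f.trdegENat = 0 := by
  let := f.toAlgebra
  have : Algebra.IsAlgebraic R S := h
  simp [trdegENat, trdeg_eq_zero]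

theorem trdegENat_eq_zero_of_surjective {R S : Type*} [CommRing R] [Nontrivial R] [CommRing S]
    (f : R →+* S) (h : Function.Surjective f) : f.trdegENat = 0 := by
  apply trdegENat_eq_zero_of_isAlgebraic
  algebraize [f]
  refine ⟨fun x => ?_⟩
  obtain ⟨r, rfl⟩ := h x
  exact isAlgebraic_algebraMap r

theorem trdegENat_algebraMap_of_isFractionRing (R F : Type*) [CommRing R] [IsDomain R] [Field F]
    [Algebra R F] [IsFractionRing R F] : (algebraMap R F).trdegENat = 0 := by
  have : Algebra.IsAlgebraic R F := IsLocalization.isAlgebraic F (nonZeroDivisors R)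
  rw [trdegENat_algebraMap, trdeg_eq_zero, map_zero]

end RingHom

namespace AlgebraicGeometry

/-- The transcendence degree of the extension of residue fields `κ(f p) → κ(p)`. -/
noncomputable def residueTrdeg {X Y : Scheme.{u}} (f : X ⟶ Y) (p : X) : ℕ∞ :=
  (f.residueFieldMap p).hom.trdegENat

/-- Additivity of transcendence degrees. For a structure morphism `g` to a field this relates the
dimensions of the closures of `p` and of `f p`. -/
theorem residueTrdeg_comp {X Y Z : Scheme.{u}} (f : X ⟶ Y) (g : Y ⟶ Z) (p : X) :
    residueTrdeg (f ≫ g) p = residueTrdeg f p + residueTrdeg g (f p) := by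
  rw [add_comm]
  unfold residueTrdeg
  rw [← RingHom.trdegENat_comp _ _ (RingHom.injective _) (RingHom.injective _),
    ← CommRingCat.hom_comp, ← Scheme.residueFieldMap_comp]
  rfl

@[simp]
theorem residueTrdeg_id {X : Scheme.{u}} (p : X) : residueTrdeg (𝟙 X) p = 0 := by
  unfold residueTrdeg
  rw [Scheme.residueFieldMap_id]
  exact RingHom.trdegENat_eq_zero_of_surjective _ Function.surjective_id

theorem residueTrdeg_eq_zero_of_surjectiveOnStalks {X Y : Scheme.{u}} (f : X ⟶ Y)
    [SurjectiveOnStalks f] (p : X) : residueTrdeg f p = 0 :=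
  RingHom.trdegENat_eq_zero_of_surjective _ <| by
    have h1 := (X.residue_surjective p).comp (SurjectiveOnStalks.stalkMap_surjective (f := f) p)
    have h2 := Scheme.residue_residueFieldMap f p
    intro x
    obtain ⟨a, rfl⟩ := h1 x
    exact ⟨Y.residue (f p) a, congr($h2 a)⟩

/-- The prime ideal of `R` given by a point of `Spec R`. -/
def primeIdeal {R : CommRingCat.{u}} (p : Spec R) : Ideal R := PrimeSpectrum.asIdeal (R := R) p

instance {R : CommRingCat.{u}} (p : Spec R) : (primeIdeal p).IsPrime :=
  PrimeSpectrum.isPrime (R := R) p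

theorem residueTrdeg_SpecMap_eq_residueField {A R : CommRingCat.{u}} (φ : A ⟶ R) (p : Spec R) :
    residueTrdeg (Spec.map φ) p =
      (Ideal.ResidueField.map ((primeIdeal p).comap φ.hom) (primeIdeal p) φ.hom rfl).trdegENat := by
  let q : Spec A := Spec.map φ p
  let eq : (Spec A).residueField q ≅ .of ((primeIdeal p).comap φ.hom).ResidueField :=
    Scheme.Spec.residueFieldIso A q
  let ep : (Spec R).residueField p ≅ .of (primeIdeal p).ResidueField :=
    Scheme.Spec.residueFieldIso R p
  let m := CommRingCat.ofHom
    (Ideal.ResidueField.map ((primeIdeal p).comap φ.hom) (primeIdeal p) φ.hom rfl)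
  have h : eq.inv ≫ (Spec.map φ).residueFieldMap p = m ≫ ep.inv := by
    ext1
    apply Ideal.ResidueField.ringHom_ext
    have h1 : CommRingCat.ofHom (algebraMap A ((primeIdeal p).comap φ.hom).ResidueField) ≫
        (eq.inv ≫ (Spec.map φ).residueFieldMap p) =
        CommRingCat.ofHom (algebraMap A ((primeIdeal p).comap φ.hom).ResidueField) ≫
          m ≫ ep.inv := by
      have h2 : CommRingCat.ofHom (algebraMap A ((primeIdeal p).comap φ.hom).ResidueField) ≫
          eq.inv = _ :=
        Scheme.Spec.algebraMap_residueFieldIso_inv A q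
      have h3 : CommRingCat.ofHom (algebraMap A ((primeIdeal p).comap φ.hom).ResidueField) ≫ m =
          φ ≫ CommRingCat.ofHom (algebraMap R (primeIdeal p).ResidueField) := by
        ext a
        exact Ideal.ResidueField.map_algebraMap _ _ _ rfl a
      have h6 : CommRingCat.ofHom (algebraMap R (primeIdeal p).ResidueField) ≫ ep.inv = _ :=
        Scheme.Spec.algebraMap_residueFieldIso_inv R p
      rw [reassoc_of% h2, reassoc_of% h3, h6]
      have h4 := Scheme.Γevaluation_naturality (Spec.map φ) p
      have h5 := Scheme.ΓSpecIso_inv_naturality φ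
      rw [reassoc_of% h5]
      exact congr((Scheme.ΓSpecIso A).inv ≫ $h4)
    exact congr(CommRingCat.Hom.hom $h1)
  have h1 : ((eq.inv ≫ (Spec.map φ).residueFieldMap p)).hom.trdegENat =
      (m ≫ ep.inv).hom.trdegENat := by rw [h]
  rw [CommRingCat.hom_comp, CommRingCat.hom_comp,
    RingHom.trdegENat_comp _ _ (RingHom.injective _) (RingHom.injective _),
    RingHom.trdegENat_comp _ _ (RingHom.injective _) (RingHom.injective _),
    RingHom.trdegENat_eq_zero_of_surjective eq.inv.hom
      (ConcreteCategory.bijective_of_isIso eq.inv).2,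
    RingHom.trdegENat_eq_zero_of_surjective ep.inv.hom
      (ConcreteCategory.bijective_of_isIso ep.inv).2, zero_add, add_zero] at h1
  exact h1

/-- Passing to the fields of fractions does not change the transcendence degree of the extension of
the quotients by the primes. -/
theorem residueTrdeg_SpecMap_eq_quotient {A R : CommRingCat.{u}} (φ : A ⟶ R) (p : Spec R) :
    residueTrdeg (Spec.map φ) p =
      (Ideal.quotientMap (primeIdeal p) φ.hom le_rfl :
        A ⧸ (primeIdeal p).comap φ.hom →+* R ⧸ (primeIdeal p)).trdegENat := by
  rw [residueTrdeg_SpecMap_eq_residueField]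
  have h : (Ideal.ResidueField.map ((primeIdeal p).comap φ.hom) (primeIdeal p) φ.hom rfl).comp
      (algebraMap (A ⧸ (primeIdeal p).comap φ.hom) ((primeIdeal p).comap φ.hom).ResidueField) =
      (algebraMap (R ⧸ (primeIdeal p)) (primeIdeal p).ResidueField).comp
        (Ideal.quotientMap (primeIdeal p) φ.hom le_rfl) := by
    ext a
    simp
  have h1 := congrArg RingHom.trdegENat h
  rw [RingHom.trdegENat_comp _ _ (RingHom.injective _) (IsFractionRing.injective _ _),
    RingHom.trdegENat_comp _ _ (IsFractionRing.injective _ _)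
      (Ideal.quotientMap_injective' le_rfl),
    RingHom.trdegENat_algebraMap_of_isFractionRing,
    RingHom.trdegENat_algebraMap_of_isFractionRing, zero_add, add_zero] at h1
  exact h1

theorem ringKrullDim_quotient_eq_residueTrdeg {k : Type u} [Field k] {R : CommRingCat.{u}}
    (φ : CommRingCat.of k ⟶ R) (hφ : φ.hom.FiniteType) (p : Spec R) :
    ringKrullDim (R ⧸ (primeIdeal p)) = residueTrdeg (Spec.map φ) p := by
  algebraize [φ.hom]
  rw [ringKrullDim_eq_trdeg k, residueTrdeg_SpecMap_eq_quotient, ← RingHom.trdegENat_algebraMap]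
  have h : algebraMap k (R ⧸ (primeIdeal p)) = (Ideal.quotientMap (primeIdeal p) φ.hom le_rfl :
      k ⧸ (primeIdeal p).comap φ.hom →+* R ⧸ (primeIdeal p)).comp (Ideal.Quotient.mk _) := by
    ext; rfl
  rw [h, RingHom.trdegENat_comp _ _ (Ideal.quotientMap_injective' le_rfl) (RingHom.injective _),
    RingHom.trdegENat_eq_zero_of_surjective _ Ideal.Quotient.mk_surjective, zero_add]

end AlgebraicGeometry

namespace AlgebraicGeometry

/-! ### Dimension of schemes locally of finite type over a field -/

section OverField

variable {k : Type u} [Field k] {X : Scheme.{u}} (s : X ⟶ Spec (.of k)) [LocallyOfFiniteType s]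

/-- Each point has an affine neighbourhood, inside any given one, on which the transcendence degree
of a residue field over `k` is the Krull dimension of a quotient by a prime ideal. -/
theorem exists_openImmersion_ringKrullDim_eq (p : X) (U : X.Opens) (hp : p ∈ U) :
    ∃ (R : CommRingCat.{u}) (j : Spec R ⟶ X), IsOpenImmersion j ∧ p ∈ Set.range j ∧
      Set.range j ⊆ U ∧
      ∀ q : Spec R, ringKrullDim (R ⧸ primeIdeal q) = residueTrdeg s (j q) := by
  obtain ⟨R, j, hj, hpj, hjU⟩ := Scheme.exists_affine_mem_range_and_range_subset hp
  refine ⟨R, j, hj, hpj, hjU, fun q => ?_⟩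
  obtain ⟨φ, hφ⟩ := Spec.map_surjective (j ≫ s)
  have h1 : LocallyOfFiniteType (Spec.map φ) := by rw [hφ]; infer_instance
  rw [HasRingHomProperty.Spec_iff (P := @LocallyOfFiniteType)] at h1
  rw [ringKrullDim_quotient_eq_residueTrdeg φ h1, hφ, residueTrdeg_comp,
    residueTrdeg_eq_zero_of_surjectiveOnStalks j, zero_add]

theorem residueTrdeg_ne_top (p : X) : residueTrdeg s p ≠ ⊤ := by
  obtain ⟨R, j, hj, hpj, hjU⟩ := Scheme.exists_affine_mem_range_and_range_subset
    (show p ∈ (⊤ : X.Opens) from trivial)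
  obtain ⟨q, rfl⟩ := hpj
  obtain ⟨φ, hφ⟩ := Spec.map_surjective (j ≫ s)
  have h1 : LocallyOfFiniteType (Spec.map φ) := by rw [hφ]; infer_instance
  rw [HasRingHomProperty.Spec_iff (P := @LocallyOfFiniteType)] at h1
  have h2 : residueTrdeg s (j q) = residueTrdeg (j ≫ s) q := by
    rw [residueTrdeg_comp, residueTrdeg_eq_zero_of_surjectiveOnStalks j, zero_add]
  have h3 := ringKrullDim_quotient_eq_residueTrdeg φ h1 q
  algebraize [φ.hom]
  rw [ringKrullDim_eq_trdeg k] at h3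
  rw [h2, ← hφ, ← WithBot.coe_inj.mp h3, Ne, Cardinal.toENat_eq_top, not_le]
  exact trdeg_lt_aleph0_of_finiteType

/-- Dividing an affine domain by a nonzero prime lowers its dimension. -/
theorem residueTrdeg_lt_of_specializes {p q : X} (h : p ⤳ q) (hne : p ≠ q) :
    residueTrdeg s q < residueTrdeg s p := by
  obtain ⟨R, j, hj, hq, -, hdim⟩ := exists_openImmersion_ringKrullDim_eq s q ⊤ trivial
  obtain ⟨p', rfl⟩ : p ∈ Set.range j := h.mem_open j.isOpenEmbedding.isOpen_range hq
  obtain ⟨q', rfl⟩ := hq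
  have h1 : p' ⤳ q' := j.isOpenEmbedding.isInducing.specializes_iff.mp h
  have h2 : primeIdeal p' ≤ primeIdeal q' := (PrimeSpectrum.le_iff_specializes (R := R) _ _).mpr h1
  have h3 : primeIdeal p' ≠ primeIdeal q' := fun h => hne (by
    rw [show p' = q' from PrimeSpectrum.ext (R := R) h])
  obtain ⟨r, hr, hr'⟩ := SetLike.exists_of_lt (lt_of_le_of_ne h2 h3)
  have h4 := ringKrullDim_succ_le_of_surjective (Ideal.Quotient.factor h2)
    (Ideal.Quotient.factor_surjective h2) (r := Ideal.Quotient.mk _ r)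
    (mem_nonZeroDivisors_of_ne_zero (by rwa [Ne, Ideal.Quotient.eq_zero_iff_mem]))
    (by rw [Ideal.Quotient.factor_mk, Ideal.Quotient.eq_zero_iff_mem]; exact hr)
  rw [hdim, hdim] at h4
  have h5 : residueTrdeg s (j q') + 1 ≤ residueTrdeg s (j p') := by exact_mod_cast h4
  exact (ENat.add_one_le_iff (residueTrdeg_ne_top s _)).mp h5

theorem residueTrdeg_le_of_specializes {p q : X} (h : p ⤳ q) :
    residueTrdeg s q ≤ residueTrdeg s p := by
  by_cases hne : p = q
  · rw [hne]
  · exact (residueTrdeg_lt_of_specializes s h hne).le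

/-- The bound holds on every open neighbourhood, so it bounds the local dimension as well. -/
theorem residueTrdeg_le_topologicalKrullDim (p : X) {U : Set X} (hU : IsOpen U) (hp : p ∈ U) :
    (residueTrdeg s p : WithBot ℕ∞) ≤ topologicalKrullDim (closure {p} ∩ U : Set X) := by
  obtain ⟨R, j, hj, ⟨q, rfl⟩, hjU, hdim⟩ := exists_openImmersion_ringKrullDim_eq s p ⟨U, hU⟩ hp
  let i : PrimeSpectrum (R ⧸ primeIdeal q) → X :=
    fun a => j (PrimeSpectrum.comap (Ideal.Quotient.mk (primeIdeal q)) a)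
  have hi : Topology.IsInducing i := j.isOpenEmbedding.isInducing.comp
    (PrimeSpectrum.isClosedEmbedding_comap_of_surjective _ _
      Ideal.Quotient.mk_surjective).isInducing
  have hmem : ∀ a, i a ∈ (closure {j q} ∩ U : Set X) := fun a => by
    refine ⟨specializes_iff_mem_closure.mp ?_, hjU ⟨_, rfl⟩⟩
    refine Specializes.map ?_ j.continuous
    refine (PrimeSpectrum.le_iff_specializes (R := R) _ _).mp ?_
    intro r hr
    change Ideal.Quotient.mk (primeIdeal q) r ∈ a.asIdeal
    have h : Ideal.Quotient.mk (primeIdeal q) r = 0 := Ideal.Quotient.eq_zero_iff_mem.mpr hr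
    rw [h]
    exact a.asIdeal.zero_mem
  rw [← hdim, ← PrimeSpectrum.topologicalKrullDim_eq_ringKrullDim]
  exact (hi.codRestrict hmem).topologicalKrullDim_le

/-- The transcendence degree strictly decreases along chains of irreducible closed subsets, which
bounds the length of such chains. -/
theorem topologicalKrullDim_closure_singleton (p : X) :
    topologicalKrullDim (closure {p} : Set X) = residueTrdeg s p := by
  refine le_antisymm ?_ ?_
  · refine iSup_le fun l => ?_
    let g : TopologicalSpace.IrreducibleCloseds (closure {p} : Set X) →
        TopologicalSpace.IrreducibleCloseds X :=
      TopologicalSpace.IrreducibleCloseds.map Subtype.val continuous_subtype_val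
    have hg : StrictMono g :=
      TopologicalSpace.IrreducibleCloseds.map_strictMono_of_isInducing
        Topology.IsInducing.subtypeVal
    let d : TopologicalSpace.IrreducibleCloseds X → ℕ∞ := fun Z =>
      residueTrdeg s Z.isIrreducible.genericPoint
    have hgen : ∀ Z : TopologicalSpace.IrreducibleCloseds X,
        IsGenericPoint Z.isIrreducible.genericPoint (Z : Set X) := fun Z =>
      Z.isIrreducible.isGenericPoint_genericPoint Z.isClosed
    have hd : StrictMono d := fun Z Z' h => by
      refine residueTrdeg_lt_of_specializes s ?_ fun h' => h.ne ?_
      · exact (hgen Z').specializes (h.le (hgen Z).mem)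
      · ext1
        rw [← (hgen Z).def, ← (hgen Z').def, h']
    have hle : ∀ Z, d (g Z) ≤ residueTrdeg s p := fun Z => by
      refine residueTrdeg_le_of_specializes s (specializes_iff_mem_closure.mpr ?_)
      have h : (g Z : Set X) ⊆ closure {p} :=
        closure_minimal (Set.image_subset_iff.mpr fun x _ => x.2) isClosed_closure
      exact h (hgen _).mem
    have hne := residueTrdeg_ne_top s p
    have hfin : ∀ i, d (g (l i)) ≠ ⊤ := fun i => ne_top_of_le_ne_top hne (hle _)
    have hlen : ∀ i : Fin (l.length + 1), ((i : ℕ) : ℕ∞) ≤ d (g (l i)) := by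
      intro i
      induction i using Fin.induction with
      | zero => exact zero_le
      | succ i ih =>
        have h1 := hd (hg (l.step i))
        have h2 := (ENat.add_one_le_iff (hfin _)).mpr h1
        refine le_trans ?_ h2
        simpa using add_le_add_left ih 1
    have := (hlen (Fin.last _)).trans (hle _)
    exact_mod_cast this
  · have h := residueTrdeg_le_topologicalKrullDim s p isOpen_univ (Set.mem_univ p)
    rwa [Set.inter_univ] at h

end OverField

/-- The residue field extension at `p` is that of `p` as a point of the fibre, a scheme over the
residue field at `f p`. The point `f p` need not be closed. -/
theorem residueTrdeg_le_topologicalKrullDim_fiber {X Y : Scheme.{u}} (f : X ⟶ Y)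
    [LocallyOfFiniteType f] (p : X) {U : Set X} (hU : IsOpen U) (hp : p ∈ U) :
    (residueTrdeg f p : WithBot ℕ∞) ≤ topologicalKrullDim (f ⁻¹' {f p} ∩ U : Set X) := by
  let i := f.fiberι (f p)
  let s := f.fiberToSpecResidueField (f p)
  let q := f.asFiber p
  have hq : i q = p := f.fiberι_asFiber p
  have : LocallyOfFiniteType s :=
    inferInstanceAs (LocallyOfFiniteType (Limits.pullback.snd f (Y.fromSpecResidueField (f p))))
  have h1 : residueTrdeg s q = residueTrdeg f p := by
    have h2 := congrArg (fun g => residueTrdeg g q) (f.fiber_fac (f p))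
    simp only at h2
    rw [residueTrdeg_comp, residueTrdeg_comp,
      residueTrdeg_eq_zero_of_surjectiveOnStalks (f.fiberι (f p)),
      residueTrdeg_eq_zero_of_surjectiveOnStalks (Y.fromSpecResidueField (f p)),
      zero_add, add_zero] at h2
    rw [← h2]
    exact congrArg _ hq
  have h2 := residueTrdeg_le_topologicalKrullDim (k := Y.residueField (f p)) s q
    (hU.preimage i.continuous) (by rwa [Set.mem_preimage, hq])
  rw [h1] at h2
  refine h2.trans ?_
  have hi : Topology.IsInducing fun a : (closure {q} ∩ i ⁻¹' U : Set (f.fiber (f p))) => i a :=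
    i.isEmbedding.isInducing.comp Topology.IsInducing.subtypeVal
  refine (hi.codRestrict (s := f ⁻¹' {f p} ∩ U) fun a => ⟨?_, a.2.2⟩).topologicalKrullDim_le
  rw [← f.range_fiberι]
  exact ⟨_, rfl⟩

/-- The fibres of a locally quasi-finite morphism are discrete. -/
theorem residueTrdeg_eq_zero_of_locallyQuasiFinite {X Y : Scheme.{u}} (f : X ⟶ Y)
    [LocallyQuasiFinite f] [LocallyOfFiniteType f] (p : X) : residueTrdeg f p = 0 := by
  have h := residueTrdeg_le_topologicalKrullDim_fiber f p isOpen_univ (Set.mem_univ p)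
  rw [Set.inter_univ] at h
  have : DiscreteTopology (f ⁻¹' {f p} : Set X) := (f.isDiscrete_preimage_singleton (f p)).1
  have h2 := h.trans (topologicalKrullDim_zero_of_discreteTopology _)
  exact nonpos_iff_eq_zero.mp (by exact_mod_cast h2)

end AlgebraicGeometry

namespace AlgebraicGeometry

/-! ### Semicontinuity of the relative transcendence degree over the base -/

/-- The affine case of `exists_isOpen_forall_residueTrdeg_le`, where the open set is the
nonvanishing locus of `a`. -/
theorem exists_notMem_forall_residueTrdeg_SpecMap_le {A R : CommRingCat.{u}} (φ : A ⟶ R)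
    (hφ : φ.hom.FiniteType) (e : Spec R) :
    ∃ a : A, φ a ∉ primeIdeal e ∧ ∀ w : Spec R, primeIdeal e ≤ primeIdeal w →
      φ a ∉ primeIdeal w → residueTrdeg (Spec.map φ) w ≤ residueTrdeg (Spec.map φ) e := by
  let P := primeIdeal e
  let Q := P.comap φ.hom
  let ψ : A ⧸ Q →+* R ⧸ P := Ideal.quotientMap P φ.hom le_rfl
  have hψinj : Function.Injective ψ := Ideal.quotientMap_injective' le_rfl
  have hψ : ψ.FiniteType := by
    refine RingHom.FiniteType.of_comp_finiteType (f := Ideal.Quotient.mk Q) ?_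
    have h : ψ.comp (Ideal.Quotient.mk Q) = (Ideal.Quotient.mk P).comp φ.hom := by ext; rfl
    rw [h]
    exact RingHom.FiniteType.comp (.of_surjective _ Ideal.Quotient.mk_surjective) hφ
  algebraize [ψ]
  have : FaithfulSMul (A ⧸ Q) (R ⧸ P) := (faithfulSMul_iff_algebraMap_injective _ _).mpr hψinj
  obtain ⟨s, hs, hle⟩ := exists_ne_zero_forall_trdeg_le (A ⧸ Q) (R ⧸ P)
  obtain ⟨a, rfl⟩ := Ideal.Quotient.mk_surjective s
  refine ⟨a, fun h => hs (Ideal.Quotient.eq_zero_iff_mem.mpr h), fun w hew haw => ?_⟩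
  let κ := (Ideal.comap φ.hom (primeIdeal w)).ResidueField
  let L := (primeIdeal w).ResidueField
  let m : κ →+* L := Ideal.ResidueField.map _ (primeIdeal w) φ.hom rfl
  let α : A ⧸ Q →+* κ := Ideal.Quotient.lift Q (algebraMap A κ) fun b hb =>
    Ideal.algebraMap_residueField_eq_zero.mpr (hew hb)
  let β : R ⧸ P →+* L := Ideal.Quotient.lift P (algebraMap R L) fun b hb =>
    Ideal.algebraMap_residueField_eq_zero.mpr (hew hb)
  have hsq : m.comp α = β.comp ψ := by
    ext b
    exact Ideal.ResidueField.map_algebraMap _ _ _ rfl b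
  have h1 : m.trdegENat ≤ ψ.trdegENat := by
    let := m.toAlgebra
    let := α.toAlgebra
    let := β.toAlgebra
    let := (m.comp α).toAlgebra
    have : IsScalarTower (A ⧸ Q) κ L := IsScalarTower.of_algebraMap_eq' rfl
    have : IsScalarTower (A ⧸ Q) (R ⧸ P) L := IsScalarTower.of_algebraMap_eq' hsq
    refine OrderHomClass.mono Cardinal.toENat (hle κ L ?_ ?_)
    · exact fun h => haw (Ideal.algebraMap_residueField_eq_zero
        (I := Ideal.comap φ.hom (primeIdeal w)).mp (show algebraMap A κ a = 0 from h))
    · intro x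
      obtain ⟨b, c, -, rfl⟩ := IsFractionRing.div_surjective (R ⧸ primeIdeal w) x
      obtain ⟨b, rfl⟩ := Ideal.Quotient.mk_surjective b
      obtain ⟨c, rfl⟩ := Ideal.Quotient.mk_surjective c
      exact ⟨Ideal.Quotient.mk _ b, Ideal.Quotient.mk _ c, rfl⟩
  rw [residueTrdeg_SpecMap_eq_residueField, residueTrdeg_SpecMap_eq_quotient _ e]
  exact h1

/-- The relative transcendence degree at `e` bounds those at the specializations of `e` lying over
some open neighbourhood of `f e`: the fibres of the closure of `e` over that neighbourhood have at
most the dimension of the generic one. -/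
theorem exists_isOpen_forall_residueTrdeg_le {X Y : Scheme.{u}} (f : X ⟶ Y)
    [LocallyOfFiniteType f] [TopologicalSpace.NoetherianSpace X] (e : X) :
    ∃ V : Set Y, IsOpen V ∧ f e ∈ V ∧
      ∀ w ∈ closure {e}, f w ∈ V → residueTrdeg f w ≤ residueTrdeg f e := by
  obtain ⟨A, i, hi, he, -⟩ := Scheme.exists_affine_mem_range_and_range_subset
    (show f e ∈ (⊤ : Y.Opens) from trivial)
  have hc : IsCompact (f ⁻¹' Set.range i) := TopologicalSpace.NoetherianSpace.isCompact _
  suffices h : ∃ V : Set Y, IsOpen V ∧ f e ∈ V ∧ ∀ w ∈ f ⁻¹' Set.range i, w ∈ closure {e} →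
      f w ∈ V → residueTrdeg f w ≤ residueTrdeg f e by
    obtain ⟨V, hV, heV, hle⟩ := h
    exact ⟨V ∩ Set.range i, hV.inter i.isOpenEmbedding.isOpen_range, ⟨heV, he⟩,
      fun w hw hwV => hle w hwV.2 hw hwV.1⟩
  refine hc.induction_on (p := fun N => ∃ V : Set Y, IsOpen V ∧ f e ∈ V ∧ ∀ w ∈ N,
    w ∈ closure {e} → f w ∈ V → residueTrdeg f w ≤ residueTrdeg f e) ?_ ?_ ?_ ?_
  · exact ⟨Set.univ, isOpen_univ, trivial, by simp⟩
  · intro N N' hst h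
    obtain ⟨V, hV, heV, hle⟩ := h
    exact ⟨V, hV, heV, fun w hw => hle w (hst hw)⟩
  · intro N N' h h'
    obtain ⟨V, hV, heV, hle⟩ := h
    obtain ⟨V', hV', heV', hle'⟩ := h'
    refine ⟨V ∩ V', hV.inter hV', ⟨heV, heV'⟩, fun w hw hwe hwV => ?_⟩
    exact hw.elim (fun hw => hle w hw hwe hwV.1) (fun hw => hle' w hw hwe hwV.2)
  · intro w₀ hw₀
    obtain ⟨R, j, hj, hw₀j, hjU⟩ := Scheme.exists_affine_mem_range_and_range_subset
      (show w₀ ∈ f ⁻¹ᵁ i.opensRange from hw₀)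
    refine ⟨Set.range j, mem_nhdsWithin_of_mem_nhds (j.isOpenEmbedding.isOpen_range.mem_nhds hw₀j),
      ?_⟩
    by_cases hej : e ∈ Set.range j
    swap
    · refine ⟨Set.univ, isOpen_univ, trivial, fun w hw hwe _ => (hej ?_).elim⟩
      exact (specializes_iff_mem_closure.mpr hwe).mem_open j.isOpenEmbedding.isOpen_range hw
    obtain ⟨e, rfl⟩ := hej
    have hrange : Set.range (j ≫ f) ⊆ Set.range i := by
      rintro _ ⟨x, rfl⟩
      exact hjU ⟨x, rfl⟩
    obtain ⟨φ, hφ⟩ := Spec.map_surjective (IsOpenImmersion.lift i (j ≫ f) hrange)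
    have hfac : Spec.map φ ≫ i = j ≫ f := by rw [hφ, IsOpenImmersion.lift_fac]
    have h1 : LocallyOfFiniteType (Spec.map φ) := by
      have : LocallyOfFiniteType (Spec.map φ ≫ i) := by rw [hfac]; infer_instance
      exact locallyOfFiniteType_of_comp _ i
    rw [HasRingHomProperty.Spec_iff (P := @LocallyOfFiniteType)] at h1
    have htr : ∀ w : Spec R, residueTrdeg f (j w) = residueTrdeg (Spec.map φ) w := by
      intro w
      have h2 := congrArg (fun g => residueTrdeg g w) hfac
      rw [residueTrdeg_comp, residueTrdeg_comp, residueTrdeg_eq_zero_of_surjectiveOnStalks i,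
        residueTrdeg_eq_zero_of_surjectiveOnStalks j, zero_add, add_zero] at h2
      exact h2.symm
    have hfj : ∀ w : Spec R, f (j w) = i (Spec.map φ w) := fun w => by
      rw [← Scheme.Hom.comp_apply, ← Scheme.Hom.comp_apply, hfac]
    obtain ⟨a, hae, ha⟩ := exists_notMem_forall_residueTrdeg_SpecMap_le φ h1 e
    refine ⟨i '' (PrimeSpectrum.basicOpen (R := A) a : Set (PrimeSpectrum A)),
      i.isOpenEmbedding.isOpenMap _ (PrimeSpectrum.basicOpen a).isOpen, ?_, ?_⟩
    · rw [hfj]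
      exact ⟨_, hae, rfl⟩
    · rintro _ ⟨w, rfl⟩ hwe hwV
      rw [hfj] at hwV
      rw [htr, htr]
      obtain ⟨b, hb, hbw⟩ := hwV
      obtain rfl := i.isOpenEmbedding.injective hbw
      refine ha w ?_ hb
      have h2 : e ⤳ w := j.isOpenEmbedding.isInducing.specializes_iff.mp
        (specializes_iff_mem_closure.mpr hwe)
      exact (PrimeSpectrum.le_iff_specializes (R := R) _ _).mpr h2

end AlgebraicGeometry

namespace DistCat

/-! ### Irreducible components in Noetherian spaces -/

section Components

variable {T : Type u} [TopologicalSpace T]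

theorem IsComponent.isClosed {W A : Set T} (h : IsComponent W A) (hA : IsClosed A) :
    IsClosed W := by
  have := h.2 ⟨h.prop.1.closure, closure_minimal h.prop.2 hA⟩ subset_closure
  exact isClosed_of_closure_subset this

theorem IsComponent.isSubvariety {W A : Set T} (h : IsComponent W A) (hA : IsClosed A) :
    IsSubvariety W :=
  ⟨h.prop.1, h.isClosed hA⟩

theorem exists_mem_superset_of_isIrreducible {B : Set T} (hB : IsIrreducible B) {ι : Type*}
    [Finite ι] {A : ι → Set T} (hA : ∀ i, IsClosed (A i)) (h : B ⊆ ⋃ i, A i) :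
    ∃ i, B ⊆ A i := by
  have hfin : (Set.range A).Finite := Set.finite_range A
  obtain ⟨_, ht, hBt⟩ := isIrreducible_iff_sUnion_isClosed.mp hB hfin.toFinset
    (by simpa using hA) (by simpa [Set.sUnion_range] using h)
  obtain ⟨i, rfl⟩ := hfin.mem_toFinset.mp ht
  exact ⟨i, hBt⟩

variable [TopologicalSpace.NoetherianSpace T]

theorem exists_isComponent_superset {A B : Set T} (hA : IsClosed A) (hB : IsIrreducible B)
    (hBA : B ⊆ A) : ∃ W, IsComponent W A ∧ B ⊆ W := by
  obtain ⟨S, hSf, hSc, hSi, rfl⟩ :=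
    TopologicalSpace.NoetherianSpace.exists_finite_set_isClosed_irreducible hA
  have key : ∀ B : Set T, IsIrreducible B → B ⊆ ⋃₀ S → ∃ t ∈ S, B ⊆ t := fun B hB h => by
    have := hSf.to_subtype
    obtain ⟨t, ht⟩ := exists_mem_superset_of_isIrreducible hB (A := fun t : S => (t : Set T))
      (fun t => hSc t t.2) (by rwa [← Set.sUnion_eq_iUnion])
    exact ⟨t, t.2, ht⟩
  obtain ⟨t, ht, hBt⟩ := key B hB hBA
  obtain ⟨b, htb, hb⟩ := hSf.exists_le_maximal ht
  refine ⟨b, ⟨⟨hSi b hb.prop, Set.subset_sUnion_of_mem hb.prop⟩, fun C hC hbC => ?_⟩,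
    hBt.trans htb⟩
  obtain ⟨t', ht', hCt'⟩ := key C hC.1 hC.2
  exact hCt'.trans (hb.2 ht' (hbC.trans hCt'))

theorem finite_setOf_isComponent {A : Set T} (hA : IsClosed A) :
    {W | IsComponent W A}.Finite := by
  obtain ⟨S, hSf, hSc, hSi, rfl⟩ :=
    TopologicalSpace.NoetherianSpace.exists_finite_set_isClosed_irreducible hA
  refine hSf.subset fun W (hW : IsComponent W _) => ?_
  have := hSf.to_subtype
  obtain ⟨t, ht⟩ := exists_mem_superset_of_isIrreducible hW.prop.1
    (A := fun t : S => (t : Set T)) (fun t => hSc t t.2)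
    (by rw [← Set.sUnion_eq_iUnion]; exact hW.prop.2)
  have h2 : (t : Set T) ⊆ W := hW.2 ⟨hSi t t.2, Set.subset_sUnion_of_mem t.2⟩ ht
  rw [ht.antisymm h2]
  exact t.2

/-- Among the closed sets that contain infinitely many elements of an infinite set, a minimal one
is irreducible, and all of its infinite subsets that are contained in the given set are dense in
it. -/
theorem exists_isSubvariety_forall_infinite_dense {D : Set T} (hD : D.Infinite) :
    ∃ B : Set T, IsSubvariety B ∧ (D ∩ B).Infinite ∧
      ∀ D' ⊆ D ∩ B, D'.Infinite → closure D' = B := by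
  let P : Set (TopologicalSpace.Closeds T) := {C | (D ∩ C).Infinite}
  have hP : P.Nonempty := ⟨⊤, by simpa [P] using hD⟩
  obtain ⟨B, hB, hmin⟩ := WellFounded.has_min
    (wellFounded_lt (α := TopologicalSpace.Closeds T)) P hP
  have hmin' : ∀ C : Set T, IsClosed C → C ⊆ B → (D ∩ C).Infinite → C = B := by
    intro C hC hCB hCD
    by_contra hne
    exact hmin ⟨C, hC⟩ hCD (lt_of_le_of_ne hCB fun h => hne congr($h))
  refine ⟨B, ⟨⟨?_, ?_⟩, B.isClosed⟩, hB, fun D' hD' hinf => ?_⟩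
  · obtain ⟨x, hx⟩ := hB.nonempty
    exact ⟨x, hx.2⟩
  · rw [isPreirreducible_iff_isClosed_union_isClosed]
    intro C₁ C₂ h₁ h₂ hB'
    have h : (D ∩ (B ∩ C₁)) ∪ (D ∩ (B ∩ C₂)) = D ∩ B := by
      rw [← Set.inter_union_distrib_left, ← Set.inter_union_distrib_left,
        Set.inter_eq_left.mpr hB']
    have hB'' : (D ∩ (B : Set T)).Infinite := hB
    rw [← h, Set.infinite_union] at hB''
    rcases hB'' with h' | h'
    · left
      rw [← hmin' _ (B.isClosed.inter h₁) Set.inter_subset_left h']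
      exact Set.inter_subset_right
    · right
      rw [← hmin' _ (B.isClosed.inter h₂) Set.inter_subset_left h']
      exact Set.inter_subset_right
  · refine hmin' _ isClosed_closure (closure_minimal (hD'.trans Set.inter_subset_right)
      B.isClosed) (hinf.mono ?_)
    exact Set.subset_inter (hD'.trans Set.inter_subset_left) subset_closure

end Components

/-! ### Points and dimensions on varieties -/

namespace Variety

variable {K : Type u} [Field K] {X Y Z : Variety K}

instance : LocallyOfFiniteType X.obj.hom := X.property.2.2.1

instance : QuasiCompact X.obj.hom := X.property.2.2.2

instance : IsIntegral X.obj.left := X.property.1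

instance : IsNoetherian X.obj.left where
  toIsLocallyNoetherian := LocallyOfFiniteType.isLocallyNoetherian X.obj.hom
  toCompactSpace := QuasiCompact.compactSpace_of_compactSpace X.obj.hom

instance : TopologicalSpace.NoetherianSpace X.Space :=
  inferInstanceAs (TopologicalSpace.NoetherianSpace X.obj.left)

instance : QuasiSober X.Space := inferInstanceAs (QuasiSober X.obj.left)

instance : T0Space X.Space := inferInstanceAs (T0Space X.obj.left)

instance : IrreducibleSpace X.Space := inferInstanceAs (IrreducibleSpace X.obj.left)

instance (f : X ⟶ Y) : LocallyOfFiniteType f.hom.left := by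
  have : LocallyOfFiniteType (f.hom.left ≫ Y.obj.hom) := by
    rw [Over.w]
    infer_instance
  exact locallyOfFiniteType_of_comp _ Y.obj.hom

theorem continuous_map (f : X ⟶ Y) : Continuous (map f) := f.hom.left.continuous

theorem map_comp (f : X ⟶ Y) (g : Y ⟶ Z) : map (f ≫ g) = map g ∘ map f := rfl

theorem map_id : map (𝟙 X) = id := rfl

theorem Point.pt_mapPoint (f : X ⟶ Y) (x : X.Point) : (mapPoint f x).pt = map f x.pt := rfl

/-- The transcendence degree over `K` of the residue field at a point of a variety; it is the
dimension of the closure of the point. -/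
noncomputable def pointDim (p : X.Space) : ℕ := (residueTrdeg X.obj.hom p).toNat

theorem coe_pointDim (p : X.Space) : (pointDim p : ℕ∞) = residueTrdeg X.obj.hom p :=
  ENat.natCast_toNat (residueTrdeg_ne_top X.obj.hom p)

theorem topologicalKrullDim_closure_singleton (p : X.Space) :
    topologicalKrullDim (closure {p} : Set X.Space) = (pointDim p : ℕ∞) := by
  rw [coe_pointDim]
  exact AlgebraicGeometry.topologicalKrullDim_closure_singleton X.obj.hom p

theorem dim_closure_singleton (p : X.Space) : dim (closure {p} : Set X.Space) = pointDim p := by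
  rw [dim, topologicalKrullDim_closure_singleton]
  rfl

theorem topologicalKrullDim_ne_top (A : Set X.Space) : topologicalKrullDim A ≠ ⊤ := by
  have h : topologicalKrullDim A ≤ (pointDim (genericPoint X.Space) : ℕ∞) := by
    rw [← topologicalKrullDim_closure_singleton, genericPoint_closure]
    exact (Topology.IsEmbedding.inclusion (Set.subset_univ A)).isInducing.topologicalKrullDim_le
  exact ne_top_of_le_ne_top (fun h => ENat.natCast_ne_top _ (WithBot.coe_inj.mp h)) h

theorem dim_mono {A B : Set X.Space} (h : A ⊆ B) : dim A ≤ dim B := by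
  have h1 : topologicalKrullDim A ≤ topologicalKrullDim B :=
    (Topology.IsEmbedding.inclusion h).isInducing.topologicalKrullDim_le
  have h2 := topologicalKrullDim_ne_top B
  unfold dim
  generalize topologicalKrullDim A = a at h1
  generalize topologicalKrullDim B = b at h1 h2
  induction a with
  | bot => exact Nat.zero_le _
  | coe a =>
    induction b with
    | bot => simp at h1
    | coe b =>
      exact ENat.toNat_le_toNat (WithBot.coe_le_coe.mp h1) fun h => h2 (by
        rw [show b = ⊤ from h]; rfl)

theorem pointDim_lt_of_specializes {p q : X.Space} (h : p ⤳ q) (hne : p ≠ q) :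
    pointDim q < pointDim p := by
  have := residueTrdeg_lt_of_specializes X.obj.hom h hne
  rw [← coe_pointDim, ← coe_pointDim] at this
  exact_mod_cast this

theorem pointDim_le_dim {A : Set X.Space} (hA : IsClosed A) {p : X.Space} (hp : p ∈ A) :
    pointDim p ≤ dim A := by
  rw [← dim_closure_singleton]
  exact dim_mono (closure_minimal (Set.singleton_subset_iff.mpr hp) hA)

theorem dim_eq_pointDim {A : Set X.Space} {p : X.Space} (hp : IsGenericPoint p A) :
    dim A = pointDim p := by
  rw [← hp.def, dim_closure_singleton]

theorem coe_pointDim_eq_add (f : X ⟶ Y) (p : X.Space) :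
    (pointDim p : ℕ∞) = residueTrdeg f.hom.left p + pointDim (map f p) := by
  rw [coe_pointDim, coe_pointDim]
  have h := residueTrdeg_comp f.hom.left Y.obj.hom p
  rw [Over.w f.hom] at h
  exact h

theorem pointDim_map_le (f : X ⟶ Y) (p : X.Space) : pointDim (map f p) ≤ pointDim p := by
  have := coe_pointDim_eq_add f p
  have h : (pointDim (map f p) : ℕ∞) ≤ pointDim p := by rw [this]; exact le_add_self
  exact_mod_cast h

theorem pointDim_map_of_locallyQuasiFinite (f : X ⟶ Y) [LocallyQuasiFinite f.hom.left]
    (p : X.Space) : pointDim (map f p) = pointDim p := by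
  have := coe_pointDim_eq_add f p
  rw [residueTrdeg_eq_zero_of_locallyQuasiFinite, zero_add] at this
  exact_mod_cast this.symm

theorem FiniteFibers.locallyQuasiFinite {f : X ⟶ Y} (hf : FiniteFibers f) :
    LocallyQuasiFinite f.hom.left :=
  .of_finite_preimage_singleton f.hom.left hf

theorem FiniteFibers.pointDim_map {f : X ⟶ Y} (hf : FiniteFibers f) (p : X.Space) :
    pointDim (map f p) = pointDim p :=
  have := hf.locallyQuasiFinite
  pointDim_map_of_locallyQuasiFinite f p

theorem isClosed_singleton_of_pointDim_eq_zero {p : X.Space} (hp : pointDim p = 0) :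
    IsClosed {p} := by
  refine isClosed_of_closure_subset fun q hq => ?_
  by_contra hne
  have := pointDim_lt_of_specializes (specializes_iff_mem_closure.mpr hq) (Ne.symm hne)
  omega

theorem Point.pointDim_pt (x : X.Point) : pointDim x.pt = 0 := by
  let i : Spec (.of K) ⟶ X.obj.left := x.left
  have h : i ≫ X.obj.hom = 𝟙 _ := Over.w x
  let c : Spec (.of K) := IsLocalRing.closedPoint K
  have h1 := residueTrdeg_comp i X.obj.hom c
  rw [h, residueTrdeg_id] at h1
  have h2 : (pointDim x.pt : ℕ∞) = 0 := by
    rw [coe_pointDim]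
    exact (add_eq_zero.mp h1.symm).2
  exact_mod_cast h2

theorem Point.isClosed_pt (x : X.Point) : IsClosed {x.pt} :=
  isClosed_singleton_of_pointDim_eq_zero x.pointDim_pt

variable [IsAlgClosed K]

theorem exists_point_of_pointDim_eq_zero {p : X.Space} (hp : pointDim p = 0) :
    ∃ x : X.Point, x.pt = p := by
  have hc := isClosed_singleton_of_pointDim_eq_zero hp
  refine ⟨Over.homMk (pointOfClosedPoint X.obj.hom p hc) (pointOfClosedPoint_comp _ _ _), ?_⟩
  exact pointOfClosedPoint_apply X.obj.hom p hc _

theorem Point.pt_injective : Function.Injective (Point.pt (X := X)) := by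
  intro x y h
  apply Over.OverMorphism.ext
  exact ext_of_apply_closedPoint_eq X.obj.hom (Over.w x) (Over.w y) h

end Variety

end DistCat

namespace DistCat

/-! ### Images of fibres in a distinguished category -/

variable {K : Type u} [Field K] {C : Type w} [Category.{v} C] {F : C ⥤ Variety K}

theorem Variety.FiniteFibers.comp {X Y Z : Variety K} {f : X ⟶ Y} {g : Y ⟶ Z}
    (hf : Variety.FiniteFibers f) (hg : Variety.FiniteFibers g) :
    Variety.FiniteFibers (f ≫ g) := by
  intro z
  rw [Variety.map_comp, Set.preimage_comp]
  exact (hg z).preimage' fun y _ => hf y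

theorem map_map_comp {X Y Z : C} (f : X ⟶ Y) (g : Y ⟶ Z) (p : (F.obj X).Space) :
    Variety.map (F.map (f ≫ g)) p = Variety.map (F.map g) (Variety.map (F.map f) p) := by
  rw [F.map_comp, Variety.map_comp, Function.comp_apply]

theorem imageOfFiber_comp {X X' Y Z : C} (φ : Y ⟶ X) (χ : X ⟶ X') (ψ : Y ⟶ Z)
    (z : (F.obj Z).Point) :
    imageOfFiber F (φ ≫ χ) ψ z = Variety.map (F.map χ) '' imageOfFiber F φ ψ z := by
  rw [imageOfFiber, imageOfFiber, F.map_comp, Variety.map_comp, Set.image_comp]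

theorem imageOfFiber_id {Y Z : C} (ψ : Y ⟶ Z) (z : (F.obj Z).Point) :
    imageOfFiber F (𝟙 Y) ψ z = Variety.map (F.map ψ) ⁻¹' {z.pt} := by
  rw [imageOfFiber, F.map_id, Variety.map_id, Set.image_id]

/-- The graph of `(φ, ψ)` has a closed image in the product, and `φ(ψ⁻¹(z))` is the preimage of
this image under the section of the first projection given by `z`. -/
theorem isClosed_imageOfFiber (hF : IsDistinguished F) {X Y Z : C} (φ : Y ⟶ X) (ψ : Y ⟶ Z)
    (z : (F.obj Z).Point) : IsClosed (imageOfFiber F φ ψ z) := by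
  obtain ⟨P, πX, πZ, hP⟩ := hF.directProducts X Z
  obtain ⟨χ, ⟨rfl, rfl⟩, -⟩ := hP.existsUnique φ ψ
  let zl : Spec (.of K) ⟶ (F.obj Z).obj.left := z.left
  have hz : zl ≫ (F.obj Z).obj.hom = 𝟙 _ := Over.w z
  let i : (F.obj X).obj.left ⟶ (F.obj P).obj.left :=
    hP.isPullback.lift (𝟙 _) ((F.obj X).obj.hom ≫ zl) (by
      rw [Category.assoc, hz, Category.id_comp, Category.comp_id])
  have hiX : i ≫ (F.map πX).hom.left = 𝟙 _ := hP.isPullback.lift_fst _ _ _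
  have hiZ : i ≫ (F.map πZ).hom.left = (F.obj X).obj.hom ≫ zl := hP.isPullback.lift_snd _ _ _
  have hiX' : ∀ p, Variety.map (F.map πX) (i p) = p := fun p => by
    have := Scheme.Hom.comp_apply i (F.map πX).hom.left p
    rw [hiX] at this
    exact this.symm
  have hiZ' : ∀ p, Variety.map (F.map πZ) (i p) = z.pt := fun p => by
    have := Scheme.Hom.comp_apply i (F.map πZ).hom.left p
    rw [hiZ] at this
    refine this.symm.trans ?_
    exact congrArg zl (Subsingleton.elim (α := PrimeSpectrum K) _ _)
  have hrange : ∀ p : (F.obj P).Space, Variety.map (F.map πZ) p = z.pt → p ∈ Set.range i := by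
    intro p hp
    let a := Limits.pullback.fst (F.map πZ).hom.left zl
    let b := Limits.pullback.snd (F.map πZ).hom.left zl
    have hab : a ≫ (F.map πZ).hom.left = b ≫ zl := Limits.pullback.condition
    have h1 : p ∈ Set.range a := by
      rw [Scheme.Pullback.range_fst]
      exact ⟨_, hp.symm⟩
    have h2 : (a ≫ (F.map πX).hom.left) ≫ i = a := by
      refine hP.isPullback.hom_ext ?_ ?_
      · rw [Category.assoc, hiX, Category.comp_id]
      · have h3 : b = a ≫ (F.map πZ).hom.left ≫ (F.obj Z).obj.hom := by
          rw [reassoc_of% hab, hz, Category.comp_id]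
        rw [Category.assoc, hiZ, Category.assoc, hP.isPullback.w_assoc, hab, h3]
        simp only [Category.assoc]
    obtain ⟨q, rfl⟩ := h1
    refine ⟨(a ≫ (F.map πX).hom.left) q, ?_⟩
    rw [← Scheme.Hom.comp_apply, h2]
  have key : imageOfFiber F (χ ≫ πX) (χ ≫ πZ) z = i ⁻¹' Set.range (Variety.map (F.map χ)) := by
    ext p
    constructor
    · rintro ⟨y, hy, rfl⟩
      rw [Set.mem_preimage, Set.mem_singleton_iff, map_map_comp] at hy
      obtain ⟨q, hq⟩ := hrange _ hy
      refine ⟨y, ?_⟩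
      rw [map_map_comp, ← hq, hiX']
    · rintro ⟨y, hy⟩
      refine ⟨y, ?_, ?_⟩
      · rw [Set.mem_preimage, Set.mem_singleton_iff, map_map_comp, hy, hiZ']
      · rw [map_map_comp, hy, hiX']
  rw [key]
  exact (hF.fiberDimension χ).1.preimage i.continuous

/-- A set of the form `φ(ψ⁻¹(z))` with `z` in the given family of sets of points. -/
def IsFiberImage (Θ : ∀ Z : C, Set (F.obj Z).Point) {X : C} (W : Set (F.obj X).Space) : Prop :=
  ∃ (Y Z : C) (φ : Y ⟶ X) (ψ : Y ⟶ Z), ∃ z ∈ Θ Z, W = imageOfFiber F φ ψ z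

/-- A family of sets of points is stable under taking preimages under distinguished morphisms with
finite fibres. -/
def IsFiniteFiberStable (Θ : ∀ Z : C, Set (F.obj Z).Point) : Prop :=
  ∀ {Y Z : C} (ξ : Y ⟶ Z) (y : (F.obj Y).Point), Variety.FiniteFibers (F.map ξ) →
    Variety.mapPoint (F.map ξ) y ∈ Θ Z → y ∈ Θ Y

theorem isFiniteFiberStable_univ : IsFiniteFiberStable (F := F) fun _ => Set.univ :=
  fun _ _ _ _ => trivial

theorem isComponent_self {T : Type u} [TopologicalSpace T] {W : Set T} (h : IsIrreducible W) :
    IsComponent W W :=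
  ⟨⟨h, subset_rfl⟩, fun _ h _ => h.2⟩

theorem IsFiberImage.image {Θ : ∀ Z : C, Set (F.obj Z).Point} {X X' : C}
    {W : Set (F.obj X).Space} (h : IsFiberImage Θ W) (χ : X ⟶ X') :
    IsFiberImage Θ (Variety.map (F.map χ) '' W) := by
  obtain ⟨Y, Z, φ, ψ, z, hz, rfl⟩ := h
  exact ⟨Y, Z, φ ≫ χ, ψ, z, hz, (imageOfFiber_comp φ χ ψ z).symm⟩

theorem IsFiberImage.isClosed (hF : IsDistinguished F) {Θ : ∀ Z : C, Set (F.obj Z).Point} {X : C}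
    {W : Set (F.obj X).Space} (h : IsFiberImage Θ W) : IsClosed W := by
  obtain ⟨Y, Z, φ, ψ, z, -, rfl⟩ := h
  exact isClosed_imageOfFiber hF φ ψ z

/-- The points of a fibre product of distinguished varieties are covered by finitely many
distinguished varieties. They can be chosen to have finite fibres over the fibre product, hence over
`X` as soon as `Y` has finite fibres over `Z`. -/
theorem exists_cover_fiberProduct (hF : IsDistinguished F) {X Y Z : C} (φ : X ⟶ Z) (ψ : Y ⟶ Z) :
    ∃ (n : ℕ) (T : Fin n → C) (a : ∀ i, T i ⟶ X) (b : ∀ i, T i ⟶ Y),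
      (∀ i t, Variety.map (F.map φ) (Variety.map (F.map (a i)) t) =
        Variety.map (F.map ψ) (Variety.map (F.map (b i)) t)) ∧
      (∀ x y, Variety.map (F.map φ) x = Variety.map (F.map ψ) y →
        ∃ i t, Variety.map (F.map (a i)) t = x ∧ Variety.map (F.map (b i)) t = y) ∧
      (Variety.FiniteFibers (F.map ψ) → ∀ i, Variety.FiniteFibers (F.map (a i))) := by
  obtain ⟨P, πX, πY, hP⟩ := hF.directProducts X Y
  obtain ⟨n, T', χ, hχ⟩ := hF.fiberedProducts φ ψ πX πY hP
  have h4 : ∀ i, ∃ (T : C) (ζ : T ⟶ P), Variety.FiniteFibers (F.map ζ) ∧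
      Set.range (Variety.map (F.map ζ)) = Set.range (Variety.map (F.map (χ i))) := by
    intro i
    obtain ⟨-, W, T, φ₁, φ₂, ζ, hcomm, -, hφ₁, hζ, hφ₂, -⟩ := hF.fiberDimension (χ i)
    refine ⟨T, ζ, hζ, ?_⟩
    rw [← hφ₂.range_comp, ← hφ₁.range_comp, ← Variety.map_comp, ← Variety.map_comp,
      ← F.map_comp, ← F.map_comp, hcomm]
  choose T ζ hζ hrange using h4
  simp_rw [← hrange] at hχ
  let p₁ := Limits.pullback.fst (F.map φ).hom.left (F.map ψ).hom.left
  let p₂ := Limits.pullback.snd (F.map φ).hom.left (F.map ψ).hom.left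
  let ι := fiberProductToProduct F hP φ ψ
  have hι₁ : ∀ g, Variety.map (F.map πX) (ι g) = p₁ g := fun g => by
    have h : ι ≫ (F.map πX).hom.left = p₁ := hP.isPullback.lift_fst _ _ _
    rw [← h, Scheme.Hom.comp_apply]
    rfl
  have hι₂ : ∀ g, Variety.map (F.map πY) (ι g) = p₂ g := fun g => by
    have h : ι ≫ (F.map πY).hom.left = p₂ := hP.isPullback.lift_snd _ _ _
    rw [← h, Scheme.Hom.comp_apply]
    rfl
  have hp : ∀ g, Variety.map (F.map φ) (p₁ g) = Variety.map (F.map ψ) (p₂ g) := fun g => by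
    have h : p₁ ≫ (F.map φ).hom.left = p₂ ≫ (F.map ψ).hom.left := Limits.pullback.condition
    have h1 := Scheme.Hom.comp_apply p₁ (F.map φ).hom.left g
    rw [h, Scheme.Hom.comp_apply] at h1
    exact h1.symm
  have hmem : ∀ i t, Variety.map (F.map (ζ i)) t ∈ Set.range ι := fun i t => by
    rw [← hχ]
    exact Set.mem_iUnion.mpr ⟨i, t, rfl⟩
  refine ⟨n, T, fun i => ζ i ≫ πX, fun i => ζ i ≫ πY, ?_, ?_, ?_⟩
  · intro i t
    obtain ⟨g, hg⟩ := hmem i t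
    rw [map_map_comp, map_map_comp, ← hg, hι₁, hι₂, hp]
  · intro x y hxy
    obtain ⟨g, hg₁, hg₂⟩ := Scheme.Pullback.exists_preimage_pullback (f := (F.map φ).hom.left)
      (g := (F.map ψ).hom.left) x y hxy
    have : ι g ∈ ⋃ i, Set.range (Variety.map (F.map (ζ i))) := by
      rw [hχ]
      exact ⟨g, rfl⟩
    obtain ⟨i, t, ht⟩ := Set.mem_iUnion.mp this
    refine ⟨i, t, ?_, ?_⟩
    · rw [map_map_comp, ht, hι₁]
      exact hg₁
    · rw [map_map_comp, ht, hι₂]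
      exact hg₂
  · intro hψ i x
    have := hψ.locallyQuasiFinite
    have : QuasiCompact (F.map ψ).hom.left := inferInstance
    have hfin : (p₁ ⁻¹' {x}).Finite := p₁.finite_preimage_singleton x
    refine ((hfin.image ι).preimage' fun q _ => hζ i q).subset ?_
    intro t ht
    obtain ⟨g, hg⟩ := hmem i t
    refine ⟨g, ?_, hg⟩
    rw [Set.mem_preimage, Set.mem_singleton_iff, map_map_comp, ← hg, hι₁] at ht
    exact ht

/-- By the axiom on fibre dimensions all irreducible components of the fibres of a distinguished
morphism, over points that need not be closed, have the same dimension. So the dimension of a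
component of the fibre over a `K`-point bounds the relative dimension of any subvariety. -/
theorem dim_le_dim_add_dim_of_isComponent (hF : IsDistinguished F) {Y Z : C} (ψ : Y ⟶ Z)
    {E : Set (F.obj Y).Space} (hE : IsSubvariety E) {B : Set (F.obj Z).Space} (hB : IsClosed B)
    (hEB : E ⊆ Variety.map (F.map ψ) ⁻¹' B) {z : (F.obj Z).Point} {W : Set (F.obj Y).Space}
    (hW : IsComponent W (Variety.map (F.map ψ) ⁻¹' {z.pt})) : dim E ≤ dim B + dim W := by
  obtain ⟨-, T, Z', φ₁, φ₂, ξ, hcomm, hfin, hφ₁, hξ, hφ₂, hirr, d, hd⟩ := hF.fiberDimension ψ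
  have hcl : IsClosed (Variety.map (F.map ψ) ⁻¹' {z.pt}) :=
    z.isClosed_pt.preimage (Variety.continuous_map _)
  have hWs := hW.isSubvariety hcl
  -- `d` is at most the dimension of `W`, because the fibre of `φ₂` over a point maps onto `W`
  have hdW : d ≤ (dim W : ℕ∞) := by
    have hwgen := hWs.1.isGenericPoint_genericPoint hWs.2
    obtain ⟨t, ht⟩ := hφ₁ hWs.1.genericPoint
    let G := Variety.map (F.map φ₂) ⁻¹' {Variety.map (F.map φ₂) t}
    have hz' : Variety.map (F.map ξ) (Variety.map (F.map φ₂) t) = z.pt := by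
      rw [← map_map_comp, ← hcomm, map_map_comp, ht]
      exact hW.prop.2 hwgen.mem
    have hclosed : IsClosed {Variety.map (F.map φ₂) t} :=
      Variety.isClosed_singleton_of_pointDim_eq_zero (by
        rw [← hξ.pointDim_map, hz', z.pointDim_pt])
    have hG : IsIrreducible G := hirr _
    have hGc : IsClosed G := hclosed.preimage (Variety.continuous_map _)
    have hggen := hG.isGenericPoint_genericPoint hGc
    have hgW : Variety.map (F.map φ₁) hG.genericPoint ∈ W := by
      have h1 : Variety.map (F.map φ₁) '' G ⊆ Variety.map (F.map ψ) ⁻¹' {z.pt} := by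
        rintro _ ⟨s, hs, rfl⟩
        rw [Set.mem_preimage, ← map_map_comp, hcomm, map_map_comp,
          show Variety.map (F.map φ₂) s = _ from hs]
        exact hz'
      have h2 : closure (Variety.map (F.map φ₁) '' G) ⊆ W := by
        refine hW.2 ⟨(hG.image _ (Variety.continuous_map _).continuousOn).closure,
          closure_minimal h1 hcl⟩ ?_
        rw [← hwgen.def, ← ht]
        exact closure_mono (Set.singleton_subset_iff.mpr ⟨t, rfl, rfl⟩)
      exact h2 (subset_closure ⟨_, hggen.mem, rfl⟩)
    rw [← hd hG.genericPoint, show Variety.map (F.map φ₂) hG.genericPoint = _ from hggen.mem]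
    refine (iInf₂_le Set.univ ⟨isOpen_univ, trivial⟩).trans ?_
    have hdim : topologicalKrullDim G = (Variety.pointDim hG.genericPoint : ℕ∞) := by
      rw [← Variety.topologicalKrullDim_closure_singleton, hggen.def]
    rw [Set.inter_univ]
    refine hdim.trans_le ?_
    have := Variety.pointDim_map_of_locallyQuasiFinite (F.map φ₁) hG.genericPoint
    rw [← this]
    exact_mod_cast Variety.pointDim_le_dim hWs.2 hgW
  have hegen := hE.1.isGenericPoint_genericPoint hE.2
  obtain ⟨t, ht⟩ := hφ₁ hE.1.genericPoint
  have h1 : (residueTrdeg (F.map φ₂).hom.left t : WithBot ℕ∞) ≤ d := by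
    rw [← hd t]
    exact le_iInf₂ fun U hU => residueTrdeg_le_topologicalKrullDim_fiber _ t hU.1 hU.2
  have h2 : residueTrdeg (F.map φ₂).hom.left t ≤ dim W := by exact_mod_cast h1.trans hdW
  have h3 := Variety.coe_pointDim_eq_add (F.map φ₂) t
  have h4 : Variety.pointDim (Variety.map (F.map φ₂) t) ≤ dim B := by
    rw [← hξ.pointDim_map]
    refine Variety.pointDim_le_dim hB ?_
    rw [← map_map_comp, ← hcomm, map_map_comp, ht]
    exact hEB hegen.mem
  rw [Variety.dim_eq_pointDim hegen, ← ht,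
    Variety.pointDim_map_of_locallyQuasiFinite (F.map φ₁) t]
  have h5 : (Variety.pointDim t : ℕ∞) ≤ dim W + dim B := by
    rw [h3]
    exact add_le_add h2 (by exact_mod_cast h4)
  rw [add_comm]
  exact_mod_cast h5

section AlgClosed

variable [IsAlgClosed K]

/-- The irreducible components of `φ(ψ⁻¹(z))` are again images of fibres. -/
theorem exists_eq_imageOfFiber (hF : IsDistinguished F) {X Y Z : C} {φ : Y ⟶ X} {ψ : Y ⟶ Z}
    {z : (F.obj Z).Point} {W : Set (F.obj X).Space} (hW : IsComponent W (imageOfFiber F φ ψ z)) :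
    ∃ (Y' Z' : C) (φ' : Y' ⟶ X) (ψ' : Y' ⟶ Z') (ξ : Z' ⟶ Z) (z' : (F.obj Z').Point),
      Variety.FiniteFibers (F.map ξ) ∧ Variety.mapPoint (F.map ξ) z' = z ∧
      W = imageOfFiber F φ' ψ' z' := by
  obtain ⟨-, T, Z', φ₁, φ₂, ξ, hcomm, -, hφ₁, hξ, hφ₂, hirr, -⟩ := hF.fiberDimension ψ
  have hpt : ∀ q : Variety.map (F.map ξ) ⁻¹' {z.pt}, ∃ z' : (F.obj Z').Point, z'.pt = q :=
    fun q => Variety.exists_point_of_pointDim_eq_zero (by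
      rw [← hξ.pointDim_map, q.2, z.pointDim_pt])
  choose z' hz' using hpt
  have hcov : W ⊆ ⋃ q, imageOfFiber F (φ₁ ≫ φ) φ₂ (z' q) := by
    intro w hw
    obtain ⟨y, hy, rfl⟩ := hW.prop.2 hw
    obtain ⟨t, rfl⟩ := hφ₁ y
    have ht : Variety.map (F.map ξ) (Variety.map (F.map φ₂) t) = z.pt := by
      rw [← map_map_comp, ← hcomm, map_map_comp]
      exact hy
    refine Set.mem_iUnion.mpr ⟨⟨_, ht⟩, t, ?_, ?_⟩
    · exact (hz' ⟨_, ht⟩).symm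
    · rw [map_map_comp]
  have := (hξ z.pt).to_subtype
  obtain ⟨q, hq⟩ := exists_mem_superset_of_isIrreducible hW.prop.1
    (fun q => isClosed_imageOfFiber hF (φ₁ ≫ φ) φ₂ (z' q)) hcov
  refine ⟨T, Z', φ₁ ≫ φ, φ₂, ξ, z' q, hξ, Variety.Point.pt_injective ?_, hq.antisymm ?_⟩
  · rw [Variety.Point.pt_mapPoint, hz', q.2]
  · refine hW.2 ⟨(hirr _).image _ (Variety.continuous_map _).continuousOn, ?_⟩ hq
    rintro _ ⟨t, ht, rfl⟩
    refine ⟨Variety.map (F.map φ₁) t, ?_, (map_map_comp _ _ _).symm⟩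
    have ht' : Variety.map (F.map φ₂) t = q := ht.trans (hz' q)
    rw [Set.mem_preimage, ← map_map_comp, hcomm, map_map_comp, ht']
    exact q.2

theorem isFiberImage_of_isComponent (hF : IsDistinguished F) {Θ : ∀ Z : C, Set (F.obj Z).Point}
    (hΘ : IsFiniteFiberStable Θ) {X Y Z : C} {φ : Y ⟶ X} {ψ : Y ⟶ Z} {z : (F.obj Z).Point}
    (hz : z ∈ Θ Z) {W : Set (F.obj X).Space} (hW : IsComponent W (imageOfFiber F φ ψ z)) :
    IsFiberImage Θ W := by
  obtain ⟨Y', Z', φ', ψ', ξ, z', hξ, hz', rfl⟩ := exists_eq_imageOfFiber hF hW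
  exact ⟨Y', Z', φ', ψ', z', hΘ ξ z' hξ (by rwa [hz']), rfl⟩

/-- The irreducible components of the preimage of an image of a fibre are images of fibres. -/
theorem IsFiberImage.of_isComponent_preimage (hF : IsDistinguished F)
    {Θ : ∀ Z : C, Set (F.obj Z).Point} (hΘ : IsFiniteFiberStable Θ) {X Y : C} (χ : Y ⟶ X)
    {B : Set (F.obj X).Space} (hB : IsFiberImage Θ B) {W : Set (F.obj Y).Space}
    (hW : IsComponent W (Variety.map (F.map χ) ⁻¹' B)) : IsFiberImage Θ W := by
  obtain ⟨Y₀, Z, φ, ψ, z, hz, rfl⟩ := hB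
  obtain ⟨n, T, a, b, hab, hex, -⟩ := exists_cover_fiberProduct hF χ φ
  have hcov : W ⊆ ⋃ i, imageOfFiber F (a i) (b i ≫ ψ) z := by
    intro y hy
    obtain ⟨y₀, hy₀, hyy⟩ := hW.prop.2 hy
    obtain ⟨i, t, rfl, rfl⟩ := hex y y₀ hyy.symm
    refine Set.mem_iUnion.mpr ⟨i, t, ?_, rfl⟩
    rw [Set.mem_preimage, map_map_comp]
    exact hy₀
  obtain ⟨i, hi⟩ := exists_mem_superset_of_isIrreducible hW.prop.1
    (fun i => isClosed_imageOfFiber hF (a i) (b i ≫ ψ) z) hcov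
  refine isFiberImage_of_isComponent hF hΘ hz (φ := a i) (ψ := b i ≫ ψ)
    ⟨⟨hW.prop.1, hi⟩, fun B hB hWB => hW.2 ⟨hB.1, hB.2.trans ?_⟩ hWB⟩
  rintro _ ⟨t, ht, rfl⟩
  rw [Set.mem_preimage, map_map_comp] at ht
  exact ⟨_, ht, (hab i t).symm⟩

/-- If `z = ξ(z')` and `z = φ(y)`, then a point of the cover of the fibre product over `(y, z')`
shows that `z'` belongs to the orbit. -/
theorem isFiniteFiberStable_sigmaOrbit (hF : IsDistinguished F) {X : C} (x : (F.obj X).Point) :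
    IsFiniteFiberStable (sigmaOrbit F x) := by
  rintro Z' Z ξ z' hξ ⟨Y, φ, ψ, y, hψ, hyx, hyz⟩
  obtain ⟨n, T, a, b, -, hex, hfin⟩ := exists_cover_fiberProduct hF φ ξ
  obtain ⟨i, t, hty, htz⟩ := hex y.pt z'.pt (by
    rw [← Variety.Point.pt_mapPoint, ← Variety.Point.pt_mapPoint, hyz])
  obtain ⟨t, rfl⟩ := Variety.exists_point_of_pointDim_eq_zero (p := t) (by
    rw [← (hfin hξ i).pointDim_map, hty, y.pointDim_pt])
  have h1 : Variety.mapPoint (F.map (a i)) t = y := Variety.Point.pt_injective hty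
  refine ⟨T i, b i, a i ≫ ψ, t, ?_, ?_, Variety.Point.pt_injective htz⟩
  · rw [F.map_comp]
    exact (hfin hξ i).comp hψ
  · rw [← hyx, ← h1]
    apply Variety.Point.pt_injective
    simp only [Variety.Point.pt_mapPoint, map_map_comp]

/-- Weakly special subvarieties are exactly the irreducible sets of the form `φ(ψ⁻¹(z))`; no passage
to a component is needed. -/
theorem isWeaklySpecial_iff (hF : IsDistinguished F) {X : C} {W : Set (F.obj X).Space} :
    IsWeaklySpecial F W ↔ IsIrreducible W ∧ IsFiberImage (fun _ => Set.univ) W := by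
  constructor
  · rintro ⟨hW, Y, Z, φ, ψ, z, h⟩
    exact ⟨hW.1, isFiberImage_of_isComponent hF isFiniteFiberStable_univ trivial h⟩
  · rintro ⟨hW, h⟩
    refine ⟨⟨hW, h.isClosed hF⟩, ?_⟩
    obtain ⟨Y, Z, φ, ψ, z, -, rfl⟩ := h
    exact ⟨Y, Z, φ, ψ, z, isComponent_self hW⟩

theorem isSigmaSpecial_iff (hF : IsDistinguished F) {X : C} (x : (F.obj X).Point) {Z : C}
    {W : Set (F.obj Z).Space} :
    IsSigmaSpecial F x W ↔ IsIrreducible W ∧ IsFiberImage (sigmaOrbit F x) W := by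
  constructor
  · rintro ⟨hW, Y, T, φ, ψ, t, ht, h⟩
    exact ⟨hW.1.1, isFiberImage_of_isComponent hF (isFiniteFiberStable_sigmaOrbit hF x) ht h⟩
  · rintro ⟨hW, h⟩
    have h' := h
    obtain ⟨Y, T, φ, ψ, t, ht, rfl⟩ := h
    refine ⟨(isWeaklySpecial_iff hF).mpr ⟨hW, Y, T, φ, ψ, t, trivial, rfl⟩,
      Y, T, φ, ψ, t, ht, isComponent_self hW⟩

end AlgClosed

end DistCat

namespace DistCat

/-! ### Optimal subvarieties -/

namespace Variety

variable {K : Type u} [Field K] {X Y : Variety K}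

theorem dim_lt_of_ssubset {W U : Set X.Space} (hW : IsSubvariety W) (hU : IsSubvariety U)
    (h : W ⊂ U) : dim W < dim U := by
  have hw := hW.1.isGenericPoint_genericPoint hW.2
  have hu := hU.1.isGenericPoint_genericPoint hU.2
  rw [dim_eq_pointDim hw, dim_eq_pointDim hu]
  refine pointDim_lt_of_specializes (hu.specializes (h.1 hw.mem)) fun h' => h.ne ?_
  rw [← hw.def, ← hu.def, h']

theorem dim_image_le {W : Set X.Space} (hW : IsSubvariety W) (f : X ⟶ Y) :
    dim (map f '' W) ≤ dim W := by
  have hw := hW.1.isGenericPoint_genericPoint hW.2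
  refine (dim_mono subset_closure).trans ?_
  rw [dim_eq_pointDim (hw.image (continuous_map f)), dim_eq_pointDim hw]
  exact pointDim_map_le f _

theorem FiniteFibers.dim_le_dim {f : X ⟶ Y} (hf : FiniteFibers f) {W : Set X.Space}
    (hW : IsSubvariety W) {A : Set Y.Space} (hA : IsClosed A) (h : W ⊆ map f ⁻¹' A) :
    dim W ≤ dim A := by
  have hw := hW.1.isGenericPoint_genericPoint hW.2
  rw [dim_eq_pointDim hw, ← hf.pointDim_map]
  exact pointDim_le_dim hA (h hw.mem)

end Variety

variable {K : Type u} [Field K] {C : Type w} [Category.{v} C] {F : C ⥤ Variety K}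

theorem subset_wsClosure {X : C} (W : Set (F.obj X).Space) : W ⊆ wsClosure F W :=
  Set.subset_sInter fun _ h => h.2

theorem wsClosure_subset {X : C} {W A : Set (F.obj X).Space} (hA : IsWeaklySpecial F A)
    (h : W ⊆ A) : wsClosure F W ⊆ A :=
  Set.sInter_subset_of_mem ⟨hA, h⟩

/-- A weakly optimal subvariety `W` of `V` is a component of the intersection of `V` with the weakly
special closure of `W`: a larger subvariety in the intersection has the same weakly special closure
and so a smaller defect. -/
theorem IsWeaklyOptimal.isComponent {X : C} {V W : Set (F.obj X).Space} (hV : IsClosed V)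
    (hW : IsWeaklyOptimal F V W) (hws : IsWeaklySpecial F (wsClosure F W)) :
    IsComponent W (wsClosure F W ∩ V) := by
  refine ⟨⟨hW.1.1, Set.subset_inter (subset_wsClosure W) hW.2.1⟩, fun B hB hWB => ?_⟩
  have hcl : closure B ⊆ wsClosure F W ∩ V := closure_minimal hB.2 (hws.1.2.inter hV)
  have hU : IsSubvariety (closure B) := ⟨hB.1.closure, isClosed_closure⟩
  have hWU : W ⊆ closure B := hWB.trans subset_closure
  by_contra hne
  have hss : W ⊂ closure B := ⟨hWU, fun h => hne (subset_closure.trans h)⟩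
  have h1 := hW.2.2 _ hU hss (hcl.trans Set.inter_subset_right)
  have h2 := Variety.dim_lt_of_ssubset hW.1 hU hss
  have h3 := Variety.dim_mono (wsClosure_subset hws (hcl.trans Set.inter_subset_left))
  unfold weakDefect at h1
  omega

/-- If the weakly special closure of a proper weakly optimal subvariety of `V` is weakly special,
then it does not contain `V`. -/
theorem IsWeaklyOptimal.not_subset_wsClosure {X : C} {V W : Set (F.obj X).Space}
    (hV : IsSubvariety V) (hW : IsWeaklyOptimal F V W)
    (hws : IsWeaklySpecial F (wsClosure F W)) (hne : W ≠ V) : ¬ V ⊆ wsClosure F W := fun h =>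
  hne (hW.2.1.antisymm ((hW.isComponent hV.2 hws).2 ⟨hV.1, Set.subset_inter h subset_rfl⟩ hW.2.1))

variable [IsAlgClosed K]

/-- A component of `φ(ψ⁻¹(z))` is the image of a component of `ψ⁻¹(z)`, because the images of the
components of `ψ⁻¹(z)` are closed. -/
theorem exists_isComponent_image_eq (hF : IsDistinguished F) {X Y Z : C} {φ : Y ⟶ X} {ψ : Y ⟶ Z}
    {z : (F.obj Z).Point} {A : Set (F.obj X).Space}
    (hA : IsComponent A (imageOfFiber F φ ψ z)) :
    ∃ W, IsComponent W (Variety.map (F.map ψ) ⁻¹' {z.pt}) ∧ Variety.map (F.map φ) '' W = A := by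
  have hcl : IsClosed (Variety.map (F.map ψ) ⁻¹' {z.pt}) :=
    z.isClosed_pt.preimage (Variety.continuous_map _)
  have := (finite_setOf_isComponent hcl).to_subtype
  have hcov : A ⊆ ⋃ W : {W | IsComponent W (Variety.map (F.map ψ) ⁻¹' {z.pt})},
      Variety.map (F.map φ) '' W := by
    intro p hp
    obtain ⟨y, hy, rfl⟩ := hA.prop.2 hp
    obtain ⟨W, hW, hyW⟩ := exists_isComponent_superset hcl isIrreducible_singleton
      (Set.singleton_subset_iff.mpr hy)
    exact Set.mem_iUnion.mpr ⟨⟨W, hW⟩, y, hyW rfl, rfl⟩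
  have himage : ∀ W : {W | IsComponent W (Variety.map (F.map ψ) ⁻¹' {z.pt})},
      IsClosed (Variety.map (F.map φ) '' (W : Set (F.obj Y).Space)) := fun W => by
    have hW : IsComponent (W : Set (F.obj Y).Space) (imageOfFiber F (𝟙 Y) ψ z) := by
      rw [imageOfFiber_id]
      exact W.2
    exact ((isFiberImage_of_isComponent hF isFiniteFiberStable_univ trivial hW).image φ).isClosed hF
  obtain ⟨⟨W, hW⟩, hAW⟩ := exists_mem_superset_of_isIrreducible hA.prop.1 himage hcov
  replace hW : IsComponent W (Variety.map (F.map ψ) ⁻¹' {z.pt}) := hW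
  refine ⟨W, hW, (hAW.antisymm (hA.2 ⟨?_, Set.image_mono hW.prop.2⟩ hAW)).symm⟩
  exact hW.prop.1.image _ (Variety.continuous_map _).continuousOn

/-- If a component of `φ(ψ⁻¹(z))` is Σ-special and `φ` has finite fibres, then `z` is Σ-special. -/
theorem isSigmaSpecialPoint_of_isSigmaSpecial (hF : IsDistinguished F) {X : C}
    (x : (F.obj X).Point) {Y Z Z' : C} {φ : Y ⟶ Z} (hφ : Variety.FiniteFibers (F.map φ))
    {ψ : Y ⟶ Z'} {z : (F.obj Z').Point} {W : Set (F.obj Y).Space}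
    (hW : IsComponent W (Variety.map (F.map ψ) ⁻¹' {z.pt}))
    (hWs : IsSigmaSpecial F x (Variety.map (F.map φ) '' W)) : IsSigmaSpecialPoint F x z := by
  have hcl : IsClosed (Variety.map (F.map ψ) ⁻¹' {z.pt}) :=
    z.isClosed_pt.preimage (Variety.continuous_map _)
  have hWsub := hW.isSubvariety hcl
  have hclA := hWs.1.1.2
  -- `W` is a component of the preimage of its image, since `φ` preserves dimensions
  have hcomp : IsComponent W (Variety.map (F.map φ) ⁻¹' (Variety.map (F.map φ) '' W)) := by
    have hclp := hclA.preimage (Variety.continuous_map (F.map φ))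
    obtain ⟨W₁, hW₁, hWW₁⟩ := exists_isComponent_superset hclp hWsub.1
      (Set.subset_preimage_image _ W)
    have hW₁s := hW₁.isSubvariety hclp
    have h1 : W = W₁ := by
      by_contra hne
      have h2 := Variety.dim_lt_of_ssubset hWsub hW₁s (hWW₁.ssubset_of_ne hne)
      have h3 := hφ.dim_le_dim hW₁s hclA hW₁.prop.2
      have h4 := Variety.dim_image_le hWsub (F.map φ)
      omega
    rwa [h1] at hW₁ ⊢
  have h1 := ((isSigmaSpecial_iff hF x).mp hWs).2
  have h2 := (h1.of_isComponent_preimage hF (isFiniteFiberStable_sigmaOrbit hF x) φ hcomp).image ψ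
  have h3 : Variety.map (F.map ψ) '' W = {z.pt} := by
    refine Set.Subset.antisymm (Set.image_subset_iff.mpr hW.prop.2) ?_
    obtain ⟨y, hy⟩ := hWsub.1.1
    exact Set.singleton_subset_iff.mpr ⟨y, hy, hW.prop.2 hy⟩
  rw [h3] at h2
  exact (isSigmaSpecial_iff hF x).mpr ⟨isIrreducible_singleton, h2⟩

/-- The points `z` such that a Σ-optimal subvariety for `V` of dimension `k` has a weakly special
closure that is a component of `φ(ψ⁻¹(z))`. -/
def sigmaOptimalPoints {X : C} (x : (F.obj X).Point) {Y Z Z' : C} (φ : Y ⟶ Z) (ψ : Y ⟶ Z')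
    (V : Set (F.obj Z).Space) (k : ℕ) : Set (F.obj Z').Space :=
  {q | ∃ z : (F.obj Z').Point, z.pt = q ∧ ∃ W, IsSigmaOptimal F x V W ∧ dim W = k ∧
    IsComponent (wsClosure F W) (imageOfFiber F φ ψ z)}

/-- The heart of the argument. If there were infinitely many such points, an infinite set of them
would be dense in an irreducible `B` of positive dimension, which is weakly special by the weak
Mordell-Lang statement. The Σ-optimal subvarieties belonging to the points of `B` sweep out a
subvariety of `V` whose dimension exceeds theirs by at least `dim B`, and it is contained in the
image of a component of `ψ⁻¹(B)`. This image is weakly special and its dimension exceeds that of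
their weakly special closures by at most `dim B`; this contradicts their optimality. -/
theorem finite_sigmaOptimalPoints (hF : IsDistinguished F) {X : C} (x : (F.obj X).Point)
    {Y Z Z' : C} {φ : Y ⟶ Z} (hφ : Variety.FiniteFibers (F.map φ)) (ψ : Y ⟶ Z') {m : ℕ}
    (hWML : WML F x Z' m) {V : Set (F.obj Z).Space} (hV : IsClosed V) (hdim : dim V ≤ m)
    (k : ℕ) : (sigmaOptimalPoints x φ ψ V k).Finite := by
  by_contra hinf
  let f := Variety.map (F.map φ)
  let g := Variety.map (F.map ψ)
  have hf : Continuous f := Variety.continuous_map _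
  have hg : Continuous g := Variety.continuous_map _
  obtain ⟨B, hB, hDB, hdense⟩ := exists_isSubvariety_forall_infinite_dense hinf
  -- `P q y` records that `y` lies over `q` and maps to the generic point of a Σ-optimal `W` of
  -- dimension `k` belonging to `q`; the component `W'` of the fibre over `q` has at most the
  -- dimension of the weakly special closure of `W`
  let P : (F.obj Z').Space → (F.obj Y).Space → Prop := fun q y => g y = q ∧
    ∃ (z : (F.obj Z').Point) (W : Set (F.obj Z).Space) (W' : Set (F.obj Y).Space), z.pt = q ∧
      IsSigmaSpecialPoint F x z ∧ IsWeaklyOptimal F V W ∧ dim W = k ∧ IsGenericPoint (f y) W ∧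
      IsComponent W' (g ⁻¹' {z.pt}) ∧ dim W' ≤ dim (wsClosure F W)
  have hP : ∀ q ∈ sigmaOptimalPoints x φ ψ V k, ∃ y, f y ∈ V ∧ P q y := by
    rintro q ⟨z, rfl, W, hW, hk, hcomp⟩
    obtain ⟨W', hW', himage⟩ := exists_isComponent_image_eq hF hcomp
    have hgen := hW.1.1.1.isGenericPoint_genericPoint hW.1.1.2
    obtain ⟨y, hy, hyW⟩ := himage.ge (subset_wsClosure W hgen.mem)
    replace hyW : f y = hW.1.1.1.genericPoint := hyW
    refine ⟨y, ?_, hW'.prop.2 hy, z, W, W', rfl, ?_, hW.1, hk, ?_, hW', ?_⟩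
    · exact hyW ▸ hW.1.2.1 hgen.mem
    · exact isSigmaSpecialPoint_of_isSigmaSpecial hF x hφ hW' (himage ▸ hW.2)
    · exact hyW ▸ hgen
    · refine hφ.dim_le_dim (hW'.isSubvariety (z.isClosed_pt.preimage hg)) hW.2.1.1.2 ?_
      rw [← himage]
      exact Set.subset_preimage_image _ _
  have hcl : IsClosed (g ⁻¹' B ∩ f ⁻¹' V) := (hB.2.preimage hg).inter (hV.preimage hf)
  obtain ⟨E, hE, hEinf⟩ : ∃ E, IsComponent E (g ⁻¹' B ∩ f ⁻¹' V) ∧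
      {q ∈ sigmaOptimalPoints x φ ψ V k ∩ B | ∃ y ∈ E, P q y}.Infinite := by
    by_contra! hfin
    refine hDB (((finite_setOf_isComponent hcl).biUnion fun E hE =>
      hfin E hE).subset ?_)
    intro q hq
    obtain ⟨y, hyV, hy⟩ := hP q hq.1
    have hymem : y ∈ g ⁻¹' B ∩ f ⁻¹' V := ⟨Set.mem_preimage.mpr (hy.1.symm ▸ hq.2), hyV⟩
    obtain ⟨E, hE, hyE⟩ := exists_isComponent_superset hcl isIrreducible_singleton
      (Set.singleton_subset_iff.mpr hymem)
    exact Set.mem_biUnion hE ⟨hq, y, hyE rfl, hy⟩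
  have hcloE := hdense _ (fun q hq => hq.1) hEinf
  have hEsub := hE.isSubvariety hcl
  have he := hEsub.1.isGenericPoint_genericPoint hEsub.2
  set e := hEsub.1.genericPoint
  -- `E` dominates `B`, since its image contains an infinite, hence dense, set of the given points
  have hge : IsGenericPoint (g e) B := by
    refine Set.Subset.antisymm
      (closure_minimal (Set.singleton_subset_iff.mpr (hE.prop.2 he.mem).1) hB.2) ?_
    rw [← hcloE]
    refine closure_minimal ?_ isClosed_closure
    rintro q ⟨-, y, hyE, hy⟩
    rw [← hy.1]
    exact specializes_iff_mem_closure.mp ((he.specializes hyE).map hg)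
  have hdimB : dim B = Variety.pointDim (g e) := Variety.dim_eq_pointDim hge
  have hBpos : 0 < dim B := by
    rw [Nat.pos_iff_ne_zero, hdimB]
    intro h0
    have h1 := (Variety.isClosed_singleton_of_pointDim_eq_zero h0).closure_eq
    rw [hge.def] at h1
    exact hDB ((Set.finite_singleton (g e)).subset (Set.inter_subset_right.trans h1.le))
  -- over `N` the fibres of `E` have at most the dimension of its generic fibre; one of the given
  -- points lies in `N`
  obtain ⟨N, hN, heN, hbound⟩ := exists_isOpen_forall_residueTrdeg_le (F.map ψ).hom.left e
  have hgeE : g e ∈ closure {q ∈ sigmaOptimalPoints x φ ψ V k ∩ B | ∃ y ∈ E, P q y} := by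
    rw [hcloE]
    exact hge.mem
  obtain ⟨q, hqN, -, y, hyE, hyq, z, W, W', rfl, -, hW, hk, hyW, hW', hdW'⟩ :=
    mem_closure_iff.mp hgeE N hN heN
  -- the relative dimension of `E` over `B` is at least `k`
  have hkE : k + dim B ≤ Variety.pointDim e := by
    have h1 := Variety.coe_pointDim_eq_add (F.map ψ) y
    have h2 := Variety.coe_pointDim_eq_add (F.map ψ) e
    have h3 : Variety.pointDim (g y) = 0 := by rw [hyq, z.pointDim_pt]
    have h4 : Variety.pointDim y = k := by
      rw [← hk, Variety.dim_eq_pointDim hyW]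
      exact (hφ.pointDim_map y).symm
    have h5 : residueTrdeg (F.map ψ).hom.left y ≤ residueTrdeg (F.map ψ).hom.left e := by
      refine hbound y ?_ ?_
      · rw [he.def]
        exact hyE
      · change g y ∈ N
        rwa [hyq]
    rw [show Variety.pointDim (Variety.map (F.map ψ) y) = 0 from h3, h4, Nat.cast_zero,
      add_zero] at h1
    have h6 : ((k + dim B : ℕ) : ℕ∞) ≤ Variety.pointDim e := by
      rw [h2, Nat.cast_add, h1, hdimB]
      exact add_le_add_left h5 _
    exact_mod_cast h6
  -- `U` is the closure of the image of `E`
  let U : Set (F.obj Z).Space := closure {f e}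
  have hU : IsSubvariety U := ⟨isIrreducible_singleton.closure, isClosed_closure⟩
  have hUV : U ⊆ V := closure_minimal (Set.singleton_subset_iff.mpr (hE.prop.2 he.mem).2) hV
  have hdimU : dim U = Variety.pointDim e := by
    rw [Variety.dim_closure_singleton]
    exact hφ.pointDim_map e
  have hWU : W ⊂ U := by
    refine LE.le.ssubset_of_ne (?_ : W ⊆ U) fun h => ?_
    · rw [← hyW.def]
      refine closure_minimal (Set.singleton_subset_iff.mpr ?_) isClosed_closure
      exact specializes_iff_mem_closure.mp ((he.specializes hyE).map hf)
    · rw [h] at hk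
      omega
  have hBm : dim B ≤ m := by
    have h1 := Variety.pointDim_map_le (F.map ψ) e
    have h2 := Variety.dim_mono hUV
    have h3 : dim B ≤ Variety.pointDim e := hdimB.trans_le h1
    omega
  have hBws : IsWeaklySpecial F B := by
    refine hWML B hB hBm ?_
    rw [← hcloE]
    refine closure_mono ?_
    rintro q ⟨hq, y, -, -, z, -, -, hz, hzs, -⟩
    rw [hcloE]
    exact ⟨hq.2, z, hzs, hz⟩
  obtain ⟨E', hE', hEE'⟩ := exists_isComponent_superset (hB.2.preimage hg) hEsub.1
    (hE.prop.2.trans Set.inter_subset_left)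
  have hE's := hE'.isSubvariety (hB.2.preimage hg)
  have himage : IsWeaklySpecial F (f '' E') := (isWeaklySpecial_iff hF).mpr
    ⟨hE's.1.image _ hf.continuousOn, (((isWeaklySpecial_iff hF).mp hBws).2.of_isComponent_preimage
      hF isFiniteFiberStable_univ ψ hE').image φ⟩
  have hUE' : U ⊆ f '' E' :=
    closure_minimal (Set.singleton_subset_iff.mpr ⟨e, hEE' he.mem, rfl⟩) himage.1.2
  have h1 := Variety.dim_mono (wsClosure_subset himage hUE')
  have h2 : dim (f '' E') ≤ dim E' := Variety.dim_image_le hE's (F.map φ)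
  have h3 := dim_le_dim_add_dim_of_isComponent hF ψ hE's hB.2 hE'.prop.2 hW'
  have h4 := hW.2.2 U hU hWU hUV
  unfold weakDefect at h4
  omega

/-- A Σ-optimal subvariety for `V` is a component of the intersection of `V` with a component of
`φ(ψ⁻¹(z))`, and only finitely many `z` occur for each of the possible dimensions. -/
theorem finite_setOf_isSigmaOptimal_of_finiteFibers (hF : IsDistinguished F) {X : C}
    (x : (F.obj X).Point) {Y Z Z' : C} {φ : Y ⟶ Z} (hφ : Variety.FiniteFibers (F.map φ))
    (ψ : Y ⟶ Z') {m : ℕ} (hWML : WML F x Z' m) {V : Set (F.obj Z).Space} (hV : IsClosed V)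
    (hdim : dim V ≤ m) :
    {W | IsSigmaOptimal F x V W ∧ ∃ z : (F.obj Z').Point,
      IsComponent (wsClosure F W) (imageOfFiber F φ ψ z)}.Finite := by
  let comps : (F.obj Z').Point → Set (Set (F.obj Z).Space) := fun z =>
    ⋃ A ∈ {A | IsComponent A (imageOfFiber F φ ψ z)}, {W | IsComponent W (A ∩ V)}
  have hcomps : ∀ z, (comps z).Finite := fun z => by
    have hcl := isClosed_imageOfFiber hF φ ψ z
    exact (finite_setOf_isComponent hcl).biUnion fun A (hA : IsComponent A _) =>
      finite_setOf_isComponent ((hA.isClosed hcl).inter hV)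
  refine ((Set.finite_le_nat (dim V)).biUnion fun k _ =>
    (finite_sigmaOptimalPoints hF x hφ ψ hWML hV hdim k).biUnion
      (t := fun q => ⋃ z : {z : (F.obj Z').Point // z.pt = q}, comps z) fun q _ => ?_).subset ?_
  · have : Subsingleton {z : (F.obj Z').Point // z.pt = q} :=
      ⟨fun z z' => Subtype.ext (Variety.Point.pt_injective (z.2.trans z'.2.symm))⟩
    exact Set.finite_iUnion fun z => hcomps z
  · rintro W ⟨hW, z, hz⟩
    refine Set.mem_biUnion (x := dim W) (Variety.dim_mono hW.1.2.1) (Set.mem_biUnion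
      (x := z.pt) ⟨z, rfl, W, hW, rfl, hz⟩ (Set.mem_iUnion.mpr ⟨⟨z, rfl⟩, ?_⟩))
    exact Set.mem_biUnion (x := wsClosure F W) hz (hW.1.isComponent hV hW.2.1)

end DistCat

theorem mainTheorem1 {K : Type u} [Field K] [IsAlgClosed K] [CharZero K]
    {C : Type w} [Category.{v} C] (F : C ⥤ DistCat.Variety K)
    (hF : DistCat.IsDistinguished F) (hA5 : DistCat.WeakFiniteness F)
    {X : C} (x : (F.obj X).Point) (Z : C) (S : Set C) (hZ : Z ∈ S)
    (hS : ∀ X' ∈ S, ∀ V : Set (F.obj X').Space, DistCat.IsSubvariety V →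
      DistCat.WeakFinitenessWithin F S X' V)
    (m : ℕ) (hWML : ∀ X' ∈ S, DistCat.WML F x X' m)
    (V : Set (F.obj Z).Space) (hV : DistCat.IsSubvariety V) (hdim : DistCat.dim V ≤ m) :
    {W : Set (F.obj Z).Space | DistCat.IsSigmaOptimal F x V W}.Finite ∧
    ∃ Δ : Set (Set (F.obj Z).Space), Δ.Finite ∧
      (∀ T ∈ Δ, DistCat.IsSigmaSpecial F x T ∧ ¬ V ⊆ T) ∧
      ∀ W : Set (F.obj Z).Space, DistCat.IsSigmaOptimal F x V W → W ≠ V →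
        ∃ T ∈ Δ, W ⊆ T := by
  have hfin : {W : Set (F.obj Z).Space | DistCat.IsSigmaOptimal F x V W}.Finite := by
    obtain ⟨n, Y, Z', φ, ψ, hmem, hex⟩ := hS Z hZ V hV
    refine (Set.finite_iUnion (f := fun i => {W | DistCat.IsSigmaOptimal F x V W ∧
      DistCat.Variety.FiniteFibers (F.map (φ i)) ∧ ∃ z : (F.obj (Z' i)).Point,
        DistCat.IsComponent (DistCat.wsClosure F W) (DistCat.imageOfFiber F (φ i) (ψ i) z)})
      fun i => ?_).subset ?_
    · by_cases hφ : DistCat.Variety.FiniteFibers (F.map (φ i))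
      · exact (DistCat.finite_setOf_isSigmaOptimal_of_finiteFibers hF x hφ (ψ i)
          (hWML _ (hmem i).2) hV.2 hdim).subset fun W hW => ⟨hW.1, hW.2.2⟩
      · exact Set.finite_empty.subset fun W hW => hφ hW.2.1
    · intro W hW
      obtain ⟨i, z, hφ, hz⟩ := hex W hW.1
      exact Set.mem_iUnion.mpr ⟨i, hW, hφ, z, hz⟩
  refine ⟨hfin, DistCat.wsClosure F '' {W | DistCat.IsSigmaOptimal F x V W ∧ W ≠ V},
    (hfin.subset fun W hW => hW.1).image _, ?_, ?_⟩
  · rintro _ ⟨W, ⟨hW, hne⟩, rfl⟩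
    exact ⟨hW.2, hW.1.not_subset_wsClosure hV hW.2.1 hne⟩
  · exact fun W hW hne => ⟨_, ⟨W, ⟨hW, hne⟩, rfl⟩, DistCat.subset_wsClosure W⟩
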